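/- A simplicial complex is a finite family $\Sigma$ of finite sets (faces) that contains $\emptyset$ and is closed under taking subsets; $\dim F=|F|-1$, $\Sigma_i$ is the set of $i$-dimensional faces, $f_i(\Sigma)=|\Sigma_i|$, and $\Sigma_{(i)}$ is the set of faces of dimension $\le i$. Let $\tilde H_i$ denote reduced simplicial homology over $\mathbb Z$ and $\tilde\beta_i$ its rank. A complex of dimension $d$ is *acyclic in positive codimension* (APC) if $\tilde\beta_j=0$ for all $j<d$. A $d$-dimensional *simplicial spanning tree* of a $d$-dimensional complex $\Sigma$ is a $d$-dimensional subcomplex $\Upsilon\subseteq\Sigma$ with $\Upsilon_{(d-1)}=\Sigma_{(d-1)}$, $\tilde H_d(\Upsilon)=0$, $|\tilde H_{d-1}(\Upsilon)|<\infty$ and $f_d(\Upsilon)=f_d(\Sigma)-\tilde\beta_d(\Sigma)+\tilde\beta_{d-1}(\Sigma)$; let $\mathcal T_d(\Sigma)$ be the set of these. Let $x_1,x_2,\dots$ be indeterminates over a field of characteristic $0$, put $X_v=x_v^2$ and $E_t=X_1+\cdots+X_t$, and work in the field of rational functions in the $x_v$. The coarsely weighted tree enumerator is $$\hat\tau_d(\Sigma)=\sum_{\Upsilon\in\mathcal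 T_d(\Sigma)}|\tilde H_{d-1}(\Upsilon)|^2\prod_{F\in\Upsilon_d}\ \prod_{v\in F}X_v .$$ **Corollary 8.2.** Let $d\ge 0$, and let $\Sigma$ be a $d$-dimensional APC simplicial complex on the vertex set $[n]=\{1,\dots,n\}$ that is *shifted*: if $1\le i<j\le n$ and $F\in\Sigma$ with $i\notin F$, $j\in F$, then $(F\setminus\{j\})\cup\{i\}\in\Sigma$. (Every pure shifted complex is APC.) Let $\Delta=\{F\setminus\{1\}:F\in\Sigma\}$ and $\Lambda=\{F: 1\notin F,\ F\cup\{1\}\in\Sigma\}$ be the deletion and the link of the vertex $1$, and let $\tilde\Delta=1*\Delta$ and $\tilde\Lambda=1*\Lambda$, where $1*\Gamma=\{F,\,F\cup\{1\}:F\in\Gamma\}$. For a family $\mathcal F$ of subsets of $[n]$ let $\deg_{\mathcal F}(v)=|\{F\in\mathcal F:v\in F\}|$. Then $$\hat\tau_d(\Sigma)=\prod_{v=1}^n X_v^{\deg_{\tilde\Lambda_d}(v)}\ \cdot\ \prod_{i}\frac{E_{\lambda'_i}}{X_1},$$ where $\lambda=\bigl(\deg_{\tilde\Delta_{d+1}}(1),\dots,\deg_{\tilde\Delta_{d+1}}(n)\bigr)$,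 $\lambda'$ is the conjugate partition, $\lambda'_i=|\{v\in[n]:\lambda_v\ge i\}|$, and the last product runs over all (positive) parts of $\lambda'$, i.e. over $1\le i\le\max_v\lambda_v$. -/

import Mathlib

open scoped BigOperators

/-- A finite family `S` of finite sets of natural numbers is an (abstract) simplicial complex:
it contains the empty face and is closed under taking subsets.  The `i`-dimensional faces are the
members with `i + 1` elements; the empty face has dimension `-1`. -/
def IsComplex (S : Finset (Finset ℕ)) : Prop :=
  ∅ ∈ S ∧ ∀ F ∈ S, ∀ G, G ⊆ F → G ∈ S

/-- The set `S_i` of `i`-dimensional faces of `S`. -/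
def facesOfDim (S : Finset (Finset ℕ)) (i : ℤ) : Finset (Finset ℕ) :=
  S.filter fun F => (F.card : ℤ) = i + 1

/-- The `i`-skeleton `S_(i)`: all faces of dimension at most `i`. -/
def skeleton (S : Finset (Finset ℕ)) (i : ℤ) : Finset (Finset ℕ) :=
  S.filter fun F => (F.card : ℤ) ≤ i + 1

/-- `dim S = d`: the maximum of the dimensions of the faces is `d`. -/
def HasDim (S : Finset (Finset ℕ)) (d : ℤ) : Prop :=
  (∃ F ∈ S, (F.card : ℤ) = d + 1) ∧ ∀ F ∈ S, (F.card : ℤ) ≤ d + 1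

/-- `S` is shifted on the vertex set `[p, q]`: all faces are subsets of `[p, q]`, and whenever
`i < j` are in `[p, q]` and `F` is a face with `i ∉ F` and `j ∈ F`, then `(F \ {j}) ∪ {i}` is
a face. -/
def IsShiftedOn (p q : ℕ) (S : Finset (Finset ℕ)) : Prop :=
  (∀ F ∈ S, F ⊆ Finset.Icc p q) ∧
    ∀ F ∈ S, ∀ i ∈ Finset.Icc p q, ∀ j ∈ Finset.Icc p q,
      i < j → i ∉ F → j ∈ F → insert i (F.erase j) ∈ S

/-- The deletion `{F \ {p} : F ∈ S}`. -/
def deletion (p : ℕ) (S : Finset (Finset ℕ)) : Finset (Finset ℕ) :=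
  S.image fun F => F.erase p

/-- The link `{F : p ∉ F, F ∪ {p} ∈ S}` (every such `F` lies in the deletion of `p`, since
`F = (F ∪ {p}) \ {p}`). -/
def link (p : ℕ) (S : Finset (Finset ℕ)) : Finset (Finset ℕ) :=
  (deletion p S).filter fun F => p ∉ F ∧ insert p F ∈ S

/-- The cone `p * S = {F, F ∪ {p} : F ∈ S}`. -/
def cone (p : ℕ) (S : Finset (Finset ℕ)) : Finset (Finset ℕ) :=
  S ∪ S.image fun F => insert p F

/-! ### Reduced simplicial homology with integer coefficients -/

/-- The sign `ε(v, F)`: it is `(-1)^(j+1)` if `v` is the `j`-th smallest element of `F` (so that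
`j - 1` elements of `F` are smaller than `v`), and `0` if `v ∉ F`. -/
def faceSign (v : ℕ) (F : Finset ℕ) : ℤ :=
  if v ∈ F then (-1) ^ (F.filter fun u => u < v).card else 0

/-- The group `C_i(S)` of simplicial `i`-chains, as functions on the set of `i`-dimensional
faces. -/
abbrev Chains (S : Finset (Finset ℕ)) (i : ℤ) : Type :=
  {F // F ∈ facesOfDim S i} → ℤ

/-- The matrix of incidence numbers, with rows indexed by the `j`-dimensional faces and columns
indexed by the `i`-dimensional faces: the entry at `(G, F)` is `ε(v, F)` if `G = F \ {v}` for some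
`v ∈ F`, and `0` otherwise.  For `j = i - 1` this is the `i`-th boundary matrix; the two indices
are kept independent so that `∂ (i + 1) i` and `∂ i (i - 1)` can be composed. -/
def boundaryMatrix (S : Finset (Finset ℕ)) (i j : ℤ) :
    Matrix {G // G ∈ facesOfDim S j} {F // F ∈ facesOfDim S i} ℤ :=
  Matrix.of fun G F => ∑ v ∈ F.1, if F.1.erase v = G.1 then faceSign v F.1 else 0

/-- The boundary map `C_i(S) → C_j(S)`, to be used with `j = i - 1`. -/
noncomputable def boundary (S : Finset (Finset ℕ)) (i j : ℤ) : Chains S i →ₗ[ℤ] Chains S j :=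
  (boundaryMatrix S i j).mulVecLin

/-- The `i`-th reduced homology group `ker ∂_i / im ∂_{i+1}` over `ℤ`. -/
abbrev RedHomology (S : Finset (Finset ℕ)) (i : ℤ) : Type :=
  LinearMap.ker (boundary S i (i - 1)) ⧸
    (LinearMap.range (boundary S (i + 1) i)).submoduleOf (LinearMap.ker (boundary S i (i - 1)))

/-- The `i`-th reduced Betti number: the rank of the `i`-th reduced homology group. -/
noncomputable def redBetti (S : Finset (Finset ℕ)) (i : ℤ) : ℕ :=
  Module.finrank ℤ (RedHomology S i)

/-- A `d`-dimensional complex is acyclic in positive codimension (APC) if its reduced Betti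
numbers in all dimensions below `d` vanish. -/
def IsAPC (S : Finset (Finset ℕ)) (d : ℤ) : Prop :=
  ∀ j : ℤ, j < d → redBetti S j = 0

/-! ### Simplicial spanning trees and their weighted enumerator -/

/-- `T` is a `k`-dimensional simplicial spanning tree of `S`. -/
structure IsSpanningTree (S : Finset (Finset ℕ)) (k : ℤ) (T : Finset (Finset ℕ)) : Prop where
  isComplex : IsComplex T
  subset : T ⊆ S
  hasDim : HasDim T k
  skeleton_eq : skeleton T (k - 1) = skeleton S (k - 1)
  acyclic : Subsingleton (RedHomology T k)
  connected : Finite (RedHomology T (k - 1))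
  count : ((facesOfDim T k).card : ℤ) =
    ((facesOfDim S k).card : ℤ) - (redBetti S k : ℤ) + (redBetti S (k - 1) : ℤ)

open Classical in
/-- The finite set of all `k`-dimensional simplicial spanning trees of `S`. -/
noncomputable def spanningTrees (S : Finset (Finset ℕ)) (k : ℤ) :
    Finset (Finset (Finset ℕ)) :=
  S.powerset.filter fun T => IsSpanningTree S k T

/-- The weighted tree enumerator `∑_T |H_{k-1}(T)|² ∏_{F ∈ T_k} x_F²`, summed over all
`k`-dimensional simplicial spanning trees `T` of `S`, where `x` assigns a weight to each face. -/
noncomputable def treeEnumerator {R : Type*} [CommRing R] (S : Finset (Finset ℕ)) (k : ℤ)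
    (x : Finset ℕ → R) : R :=
  ∑ T ∈ spanningTrees S k,
    (Nat.card (RedHomology T (k - 1)) : R) ^ 2 * ∏ F ∈ facesOfDim T k, x F ^ 2

/-! ### The coarse weighting -/

/-- The indeterminate `x_v` in the field of rational functions over `𝕜`. -/
noncomputable def xVar (𝕜 : Type*) [Field 𝕜] (v : ℕ) : FractionRing (MvPolynomial ℕ 𝕜) :=
  algebraMap (MvPolynomial ℕ 𝕜) (FractionRing (MvPolynomial ℕ 𝕜)) (MvPolynomial.X v)

/-- `X_v = x_v²`. -/
noncomputable def XVar (𝕜 : Type*) [Field 𝕜] (v : ℕ) : FractionRing (MvPolynomial ℕ 𝕜) :=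
  xVar 𝕜 v ^ 2

/-- The linear form `E_t = X_1 + ⋯ + X_t`. -/
noncomputable def EForm (𝕜 : Type*) [Field 𝕜] (t : ℕ) : FractionRing (MvPolynomial ℕ 𝕜) :=
  ∑ i ∈ Finset.Icc 1 t, XVar 𝕜 i

/-- The coarse weight `x_F = ∏_{v ∈ F} x_v` of a face. -/
noncomputable def coarseWeight (𝕜 : Type*) [Field 𝕜] (F : Finset ℕ) :
    FractionRing (MvPolynomial ℕ 𝕜) :=
  ∏ v ∈ F, xVar 𝕜 v

/-! ### Degree sequences and conjugate partitions -/

/-- The degree of `v` in a family of sets: the number of members containing `v`. -/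
def familyDegree (𝓕 : Finset (Finset ℕ)) (v : ℕ) : ℕ :=
  (𝓕.filter fun F => v ∈ F).card

/-- The `i`-th part `#{v : l_v ≥ i}` (`i ≥ 1`) of the conjugate of the partition
`l = (l_1, …, l_n)`. -/
def conjPart (n : ℕ) (l : ℕ → ℕ) (i : ℕ) : ℕ :=
  ((Finset.Icc 1 n).filter fun v => i ≤ l v).card

/-- The number of (positive) parts of the conjugate of the partition `l = (l_1, …, l_n)`, which is
the largest part of `l`. -/
def conjLength (n : ℕ) (l : ℕ → ℕ) : ℕ :=
  (Finset.Icc 1 n).sup l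

/-- The **Cauchy–Binet formula**, with the columns of the first factor indexed by a finset. -/
theorem det_sum_mul_eq_sum_powersetCard {n α R : Type*} [Fintype n] [DecidableEq n]
    [DecidableEq α] [CommRing R] (s : Finset α) (A : Matrix n α R) (B : Matrix α n R)
    (c : Finset α → R)
    (hc : ∀ J ⊆ s, ∀ e : n ≃ J, c J =
      (A.submatrix id fun i => (e i : α)).det * (B.submatrix (fun i => (e i : α)) id).det) :
    (Matrix.of fun i j => ∑ a ∈ s, A i a * B a j).det =
      ∑ J ∈ s.powersetCard (Fintype.card n), c J := by
  have hexp : (Matrix.of fun i j => ∑ a ∈ s, A i a * B a j).det =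
      ∑ f ∈ Fintype.piFinset fun _ : n => s, (∏ i, A i (f i)) * (B.submatrix f id).det := by
    have hrow : (Matrix.of fun i j => ∑ a ∈ s, A i a * B a j) =
        fun i => ∑ a ∈ s, A i a • B a := by
      ext i j
      simp [Finset.sum_apply]
    rw [hrow]
    have h := (Matrix.detRowAlternating (n := n) (R := R)).toMultilinearMap.map_sum_finset
      (fun i a => A i a • B a) (fun _ => s)
    refine h.trans (Finset.sum_congr rfl fun f _ => ?_)
    exact (Matrix.detRowAlternating (n := n) (R := R)).toMultilinearMap.map_smul_univ
      (fun i => A i (f i)) (fun i => B (f i))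
  rw [hexp]
  classical
  rw [← Finset.sum_filter_of_ne (p := Function.Injective)]
  swap
  · intro f _ hf
    by_contra hinj
    obtain ⟨i, j, hij, hne⟩ : ∃ i j, f i = f j ∧ i ≠ j := by
      simpa [Function.Injective] using hinj
    refine hf ?_
    rw [Matrix.det_zero_of_row_eq hne (by ext k; simp [hij]), mul_zero]
  rw [← Finset.sum_fiberwise_of_maps_to (t := s.powersetCard (Fintype.card n))
    (g := fun f => Finset.univ.image f)]
  swap
  · intro f hf
    rw [Finset.mem_filter, Fintype.mem_piFinset] at hf
    rw [Finset.mem_powersetCard, Finset.card_image_of_injective _ hf.2, Finset.card_univ]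
    refine ⟨fun a ha => ?_, rfl⟩
    obtain ⟨i, _, rfl⟩ := Finset.mem_image.1 ha
    exact hf.1 i
  refine Finset.sum_congr rfl fun J hJ => ?_
  rw [Finset.mem_powersetCard] at hJ
  have e : n ≃ J := Fintype.equivOfCardEq (by simp [hJ.2])
  rw [hc J hJ.1 e, ← Matrix.det_transpose (A.submatrix _ _), Matrix.det_apply', Finset.sum_mul]
  symm
  refine Finset.sum_bij (fun σ _ i => (e (σ i) : α)) ?_ ?_ ?_ ?_
  · intro σ _
    simp only [Finset.mem_filter, Fintype.mem_piFinset]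
    refine ⟨⟨fun i => hJ.1 (e (σ i)).2, fun i j h => by simpa using h⟩, ?_⟩
    ext a
    simp only [Finset.mem_image, Finset.mem_univ, true_and]
    constructor
    · rintro ⟨i, rfl⟩
      exact (e (σ i)).2
    · intro ha
      exact ⟨σ.symm (e.symm ⟨a, ha⟩), by simp⟩
  · intro σ _ τ _ h
    ext i
    simpa using congrFun h i
  · intro f hf
    simp only [Finset.mem_filter, Fintype.mem_piFinset] at hf
    have hmem : ∀ i, f i ∈ J := fun i => hf.2 ▸ Finset.mem_image_of_mem f (Finset.mem_univ i)
    have hinj : Function.Injective fun i => e.symm ⟨f i, hmem i⟩ := fun i j h =>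
      hf.1.2 (by simpa using h)
    exact ⟨Equiv.ofBijective _ (Finite.injective_iff_bijective.1 hinj), Finset.mem_univ _,
      by ext i; simp⟩
  · intro σ _
    have h := Matrix.det_permute σ (B.submatrix (fun i => (e i : α)) id)
    rw [Matrix.submatrix_submatrix] at h
    simp only [Function.comp_def, id_eq] at h
    change _ = _ * (B.submatrix (fun i => (e (σ i) : α)) id).det
    have h' : (B.submatrix (fun i => (e (σ i) : α)) id).det =
        (Equiv.Perm.sign σ : ℤ) * (B.submatrix (fun i => (e i : α)) id).det := h
    rw [h']
    simp only [Matrix.transpose_apply, Matrix.submatrix_apply, id]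
    ring

/-- The entry at `(G, F)` of the simplicial boundary matrix in which removing the vertex `v` has
weight `x v`. -/
def weightedIncidence {R : Type*} [CommRing R] (x : ℕ → R) (G F : Finset ℕ) : R :=
  ∑ v ∈ F, if F.erase v = G then (faceSign v F : R) * x v else 0

section Incidence

variable {R : Type*} [CommRing R] (x : ℕ → R)

theorem sum_weightedIncidence_mul {B : Finset (Finset ℕ)} {F : Finset ℕ}
    (hB : ∀ v ∈ F, F.erase v ∈ B) (h : Finset ℕ → R) :
    ∑ G ∈ B, weightedIncidence x G F * h G =
      ∑ v ∈ F, (faceSign v F : R) * x v * h (F.erase v) := by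
  simp only [weightedIncidence, Finset.sum_mul, ite_mul, zero_mul]
  rw [Finset.sum_comm]
  refine Finset.sum_congr rfl fun v hv => ?_
  rw [Finset.sum_ite_eq, if_pos (hB v hv)]

theorem weightedIncidence_eq_zero {G F : Finset ℕ} (h : ∀ v ∈ F, F.erase v ≠ G) :
    weightedIncidence x G F = 0 :=
  Finset.sum_eq_zero fun v hv => if_neg (h v hv)

theorem faceSign_insert_self {p : ℕ} {F : Finset ℕ} (hF : ∀ v ∈ F, p < v) :
    faceSign p (insert p F) = 1 := by
  rw [faceSign, if_pos (Finset.mem_insert_self p F), Finset.filter_eq_empty_iff.2, Finset.card_empty,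
    pow_zero]
  intro v hv
  rcases Finset.mem_insert.1 hv with rfl | hv
  · exact lt_irrefl _
  · exact (hF v hv).le.not_gt

theorem faceSign_insert {p v : ℕ} {F : Finset ℕ} (hF : ∀ v ∈ F, p < v) (hv : v ∈ F) :
    faceSign v (insert p F) = -faceSign v F := by
  have hp : p ∉ F := fun h => lt_irrefl p (hF p h)
  rw [faceSign, faceSign, if_pos (Finset.mem_insert_of_mem hv), if_pos hv, Finset.filter_insert,
    if_pos (hF v hv), Finset.card_insert_of_notMem (by simp [hp]), pow_succ]
  ring

theorem weightedIncidence_insert_right {p : ℕ} {G F : Finset ℕ} (hF : ∀ v ∈ F, p < v)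
    (hG : p ∉ G) : weightedIncidence x G (insert p F) = if G = F then x p else 0 := by
  have hp : p ∉ F := fun h => lt_irrefl p (hF p h)
  rw [weightedIncidence, Finset.sum_insert hp, Finset.erase_insert hp, faceSign_insert_self hF,
    Finset.sum_eq_zero, add_zero]
  · simp [eq_comm]
  · intro v hv
    refine if_neg fun h => hG ?_
    rw [← h, Finset.mem_erase]
    exact ⟨(hF v hv).ne, Finset.mem_insert_self _ _⟩

theorem weightedIncidence_insert_left {p : ℕ} {G F : Finset ℕ} (hF : p ∉ F) :
    weightedIncidence x (insert p G) F = 0 :=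
  weightedIncidence_eq_zero x fun _ _ h =>
    hF (Finset.mem_of_mem_erase (h ▸ Finset.mem_insert_self p G))

theorem weightedIncidence_insert_insert {p : ℕ} {G F : Finset ℕ} (hF : ∀ v ∈ F, p < v)
    (hG : p ∉ G) :
    weightedIncidence x (insert p G) (insert p F) = -weightedIncidence x G F := by
  have hp : p ∉ F := fun h => lt_irrefl p (hF p h)
  rw [weightedIncidence, weightedIncidence, Finset.sum_insert hp, Finset.erase_insert hp,
    if_neg (fun h : F = insert p G => hp (h ▸ Finset.mem_insert_self p G)), zero_add,
    ← Finset.sum_neg_distrib]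
  refine Finset.sum_congr rfl fun v hv => ?_
  have herase : (insert p F).erase v = insert p (F.erase v) :=
    Finset.erase_insert_of_ne (hF v hv).ne
  have hiff : insert p (F.erase v) = insert p G ↔ F.erase v = G := by
    refine ⟨fun h => ?_, fun h => by rw [h]⟩
    rw [← Finset.erase_insert hG, ← h, Finset.erase_insert]
    exact fun h => hp (Finset.mem_of_mem_erase h)
  rw [herase, faceSign_insert hF hv]
  by_cases h : F.erase v = G
  · rw [if_pos h, if_pos (hiff.2 h)]
    push_cast
    ring
  · rw [if_neg h, if_neg (mt hiff.1 h), neg_zero]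

/-- The boundary matrix on the simplex with vertices `p, …, n`. -/
def simplexBoundary (p n : ℕ) :
    Matrix {G // G ∈ (Finset.Icc p n).powerset} {G // G ∈ (Finset.Icc p n).powerset} R :=
  Matrix.of fun G F => weightedIncidence x G.1 F.1

/-- The diagonal projection onto the faces belonging to `K`. -/
def faceProjection (R : Type*) [CommRing R] (p n : ℕ) (K : Finset (Finset ℕ)) :
    Matrix {G // G ∈ (Finset.Icc p n).powerset} {G // G ∈ (Finset.Icc p n).powerset} R :=
  Matrix.diagonal fun G => if G.1 ∈ K then 1 else 0

theorem lt_of_mem_powerset_Icc_succ {p n v : ℕ} {F : Finset ℕ}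
    (hF : F ∈ (Finset.Icc (p + 1) n).powerset) (hv : v ∈ F) : p < v :=
  (Finset.mem_Icc.1 (Finset.mem_powerset.1 hF hv)).1

theorem notMem_of_mem_powerset_Icc_succ {p n : ℕ} {F : Finset ℕ}
    (hF : F ∈ (Finset.Icc (p + 1) n).powerset) : p ∉ F :=
  fun h => lt_irrefl p (lt_of_mem_powerset_Icc_succ hF h)

theorem mem_powerset_Icc_of_succ {p n : ℕ} {F : Finset ℕ}
    (hF : F ∈ (Finset.Icc (p + 1) n).powerset) : F ∈ (Finset.Icc p n).powerset :=
  Finset.mem_powerset.2 ((Finset.mem_powerset.1 hF).trans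
    (Finset.Icc_subset_Icc_left (Nat.le_succ p)))

theorem insert_mem_powerset_Icc {p n : ℕ} (hpn : p ≤ n) {F : Finset ℕ}
    (hF : F ∈ (Finset.Icc (p + 1) n).powerset) : insert p F ∈ (Finset.Icc p n).powerset :=
  Finset.mem_powerset.2 (Finset.insert_subset (Finset.left_mem_Icc.2 hpn)
    (Finset.mem_powerset.1 (mem_powerset_Icc_of_succ hF)))

theorem mem_powerset_Icc_succ {p n : ℕ} {F : Finset ℕ} (hF : F ∈ (Finset.Icc p n).powerset)
    (hp : p ∉ F) : F ∈ (Finset.Icc (p + 1) n).powerset := by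
  rw [Finset.mem_powerset] at hF ⊢
  intro v hv
  have h := Finset.mem_Icc.1 (hF hv)
  have : v ≠ p := fun h => hp (h ▸ hv)
  exact Finset.mem_Icc.2 ⟨by lia, h.2⟩

theorem erase_mem_powerset_Icc_succ {p n : ℕ} {F : Finset ℕ}
    (hF : F ∈ (Finset.Icc p n).powerset) : F.erase p ∈ (Finset.Icc (p + 1) n).powerset :=
  mem_powerset_Icc_succ (Finset.mem_powerset.2
    ((Finset.erase_subset p F).trans (Finset.mem_powerset.1 hF))) (Finset.notMem_erase p F)

/-- The faces of the simplex on `p, …, n` split into those avoiding and those containing `p`. -/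
noncomputable def simplexSplit {p n : ℕ} (hpn : p ≤ n) :
    {G // G ∈ (Finset.Icc (p + 1) n).powerset} ⊕ {G // G ∈ (Finset.Icc (p + 1) n).powerset} ≃
      {G // G ∈ (Finset.Icc p n).powerset} :=
  Equiv.ofBijective
    (Sum.elim (fun G => ⟨G.1, mem_powerset_Icc_of_succ G.2⟩)
      (fun G => ⟨insert p G.1, insert_mem_powerset_Icc hpn G.2⟩)) (by
    constructor
    · rintro (⟨G, hG⟩ | ⟨G, hG⟩) (⟨F, hF⟩ | ⟨F, hF⟩) h <;>
        simp only [Sum.elim_inl, Sum.elim_inr, Subtype.mk.injEq] at h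
      · simp [h]
      · exact (notMem_of_mem_powerset_Icc_succ hG (h ▸ Finset.mem_insert_self p F)).elim
      · exact (notMem_of_mem_powerset_Icc_succ hF (h ▸ Finset.mem_insert_self p G)).elim
      · have hGF : G = F := by
          rw [← Finset.erase_insert (notMem_of_mem_powerset_Icc_succ hG), h,
            Finset.erase_insert (notMem_of_mem_powerset_Icc_succ hF)]
        simp [hGF]
    · rintro ⟨F, hF⟩
      by_cases hp : p ∈ F
      · exact ⟨Sum.inr ⟨F.erase p, erase_mem_powerset_Icc_succ hF⟩,
          Subtype.ext (Finset.insert_erase hp)⟩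
      · exact ⟨Sum.inl ⟨F, mem_powerset_Icc_succ hF hp⟩, rfl⟩)

theorem simplexSplit_inl {p n : ℕ} (hpn : p ≤ n)
    (G : {G // G ∈ (Finset.Icc (p + 1) n).powerset}) :
    (simplexSplit hpn (Sum.inl G)).1 = G.1 :=
  rfl

theorem simplexSplit_inr {p n : ℕ} (hpn : p ≤ n)
    (G : {G // G ∈ (Finset.Icc (p + 1) n).powerset}) :
    (simplexSplit hpn (Sum.inr G)).1 = insert p G.1 :=
  rfl

theorem simplexBoundary_submatrix_simplexSplit {p n : ℕ} (hpn : p ≤ n) :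
    (simplexBoundary x p n).submatrix (simplexSplit hpn) (simplexSplit hpn) =
      Matrix.fromBlocks (simplexBoundary x (p + 1) n) (x p • 1) 0
        (-simplexBoundary x (p + 1) n) := by
  ext (⟨G, hG⟩ | ⟨G, hG⟩) (⟨F, hF⟩ | ⟨F, hF⟩) <;>
    simp only [simplexBoundary, simplexSplit_inl, simplexSplit_inr, Matrix.submatrix_apply,
      Matrix.fromBlocks_apply₁₁, Matrix.fromBlocks_apply₁₂,
      Matrix.fromBlocks_apply₂₁, Matrix.fromBlocks_apply₂₂, Matrix.of_apply, Matrix.zero_apply,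
      Matrix.neg_apply, Matrix.smul_apply, Matrix.one_apply, Subtype.mk.injEq]
  · rw [weightedIncidence_insert_right x (fun v hv => lt_of_mem_powerset_Icc_succ hF hv)
      (notMem_of_mem_powerset_Icc_succ hG)]
    simp
  · rw [weightedIncidence_insert_left x (notMem_of_mem_powerset_Icc_succ hF)]
  · rw [weightedIncidence_insert_insert x (fun v hv => lt_of_mem_powerset_Icc_succ hF hv)
      (notMem_of_mem_powerset_Icc_succ hG)]

theorem simplexBoundary_mul_self (p n : ℕ) :
    simplexBoundary x p n * simplexBoundary x p n = 0 := by
  induction hm : n + 1 - p generalizing p with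
  | zero =>
    ext ⟨G, hG⟩ ⟨F, hF⟩
    have hF' : F = ∅ := by
      rwa [Finset.Icc_eq_empty (by lia), Finset.powerset_empty, Finset.mem_singleton] at hF
    rw [Matrix.mul_apply]
    exact Finset.sum_eq_zero fun _ _ => by simp [simplexBoundary, weightedIncidence, hF']
  | succ m ih =>
    have hpn : p ≤ n := by lia
    have h := ih (p + 1) (by lia)
    have key : (simplexBoundary x p n * simplexBoundary x p n).submatrix
        (simplexSplit hpn) (simplexSplit hpn) = 0 := by
      rw [← Matrix.submatrix_mul_equiv _ _ _ (simplexSplit hpn),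
        simplexBoundary_submatrix_simplexSplit, Matrix.fromBlocks_multiply]
      simp [h]
    ext G F
    have := congrFun (congrFun key ((simplexSplit hpn).symm G)) ((simplexSplit hpn).symm F)
    simpa using this

theorem sum_weightedIncidence_mul_weightedIncidence {B : Finset (Finset ℕ)} {F : Finset ℕ}
    (hB : ∀ v ∈ F, F.erase v ∈ B) (H : Finset ℕ) :
    ∑ G ∈ B, weightedIncidence x H G * weightedIncidence x G F = 0 := by
  by_cases hH : H ⊆ F
  swap
  · refine Finset.sum_eq_zero fun G _ => ?_
    by_contra hne
    refine hH ?_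
    obtain ⟨v, -, hv⟩ : ∃ v ∈ F, F.erase v = G := by
      by_contra! h
      exact hne (by rw [weightedIncidence_eq_zero x h, mul_zero])
    obtain ⟨w, -, hw⟩ : ∃ w ∈ G, G.erase w = H := by
      by_contra! h
      exact hne (by rw [weightedIncidence_eq_zero x h, zero_mul])
    rw [← hw, ← hv]
    exact (Finset.erase_subset _ _).trans (Finset.erase_subset _ _)
  obtain ⟨n, hn⟩ : ∃ n, F ⊆ Finset.Icc 0 n := by
    refine ⟨F.sup id, fun v hv => Finset.mem_Icc.2 ⟨Nat.zero_le v, ?_⟩⟩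
    exact Finset.le_sup (f := id) hv
  have h := congrFun (congrFun (simplexBoundary_mul_self x 0 n)
    ⟨H, Finset.mem_powerset.2 (hH.trans hn)⟩) ⟨F, Finset.mem_powerset.2 hn⟩
  rw [Matrix.mul_apply] at h
  simp only [simplexBoundary, Matrix.of_apply, Matrix.zero_apply] at h
  rw [Finset.sum_coe_sort (Finset.Icc 0 n).powerset
    fun G => weightedIncidence x H G * weightedIncidence x G F] at h
  simp only [mul_comm (weightedIncidence x H _)] at h ⊢
  rw [sum_weightedIncidence_mul x (fun v _ =>
    Finset.mem_powerset.2 ((Finset.erase_subset v F).trans hn))] at h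
  rw [sum_weightedIncidence_mul x hB, h]

end Incidence

section GramDeterminant

/-- The deletion–link recursion for the determinant of `1 + t⁻¹ ∂ P ∂ᵀ`, in block form. -/
theorem det_one_add_smul_fromBlocks {ι R : Type*} [Fintype ι] [DecidableEq ι] [Field R]
    (D PD PL : Matrix ι ι R) (x s t : R) (hs : s ≠ 0) (ht : t ≠ 0) (hst : s = t + x ^ 2)
    (hD : D * D = 0) (hPL : PL * PL = PL)
    (hLD : PL * (D * PD) = D * PD) :
    (1 + t⁻¹ • (Matrix.fromBlocks D (x • 1) 0 (-D) * Matrix.fromBlocks PD 0 0 PL *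
        (Matrix.fromBlocks D (x • 1) 0 (-D)).transpose)).det =
      (1 + (x ^ 2 / t) • PL).det * (1 + s⁻¹ • (D * PD * D.transpose)).det *
        (1 + s⁻¹ • (D * PL * D.transpose)).det := by
  have h1 : 1 + t⁻¹ • (Matrix.fromBlocks D (x • 1) 0 (-D) * Matrix.fromBlocks PD 0 0 PL *
        (Matrix.fromBlocks D (x • 1) 0 (-D)).transpose) =
      Matrix.fromBlocks (1 + t⁻¹ • (D * PD * D.transpose + x ^ 2 • PL))
        (-((x / t) • (PL * D.transpose))) (-((x / t) • (D * PL)))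
        (1 + t⁻¹ • (D * PL * D.transpose)) := by
    rw [Matrix.fromBlocks_transpose, Matrix.fromBlocks_multiply, Matrix.fromBlocks_multiply,
      Matrix.fromBlocks_smul, ← Matrix.fromBlocks_one, Matrix.fromBlocks_add]
    congr 1
    · simp [smul_smul, pow_two]
    · simp [smul_smul, div_eq_inv_mul]
    · simp [smul_smul, div_eq_inv_mul]
    · simp
  have h2 : Matrix.fromBlocks 1 0 ((x / s) • (D * PL)) (1 : Matrix ι ι R) *
      Matrix.fromBlocks (1 + t⁻¹ • (D * PD * D.transpose + x ^ 2 • PL))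
        (-((x / t) • (PL * D.transpose))) (-((x / t) • (D * PL)))
        (1 + t⁻¹ • (D * PL * D.transpose)) =
      Matrix.fromBlocks (1 + t⁻¹ • (D * PD * D.transpose + x ^ 2 • PL))
        (-((x / t) • (PL * D.transpose))) 0 (1 + s⁻¹ • (D * PL * D.transpose)) := by
    have h3 : D * PL * (D * PD * D.transpose) = 0 := by
      rw [← Matrix.mul_assoc, Matrix.mul_assoc D PL, hLD, ← Matrix.mul_assoc, hD, Matrix.zero_mul,
        Matrix.zero_mul]
    have h4 : D * PL * PL = D * PL := by rw [Matrix.mul_assoc, hPL]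
    have h5 : D * PL * (PL * D.transpose) = D * PL * D.transpose := by
      rw [← Matrix.mul_assoc, h4]
    rw [Matrix.fromBlocks_multiply]
    congr 1
    · simp
    · simp
    · simp only [Matrix.smul_mul, Matrix.mul_add, Matrix.mul_one, Matrix.mul_smul, h3, h4,
        Matrix.one_mul, smul_zero, zero_add, smul_add, smul_smul]
      rw [← add_smul, ← sub_eq_add_neg, ← sub_smul]
      have : x / s + t⁻¹ * x ^ 2 * (x / s) - x / t = 0 := by
        field_simp
        rw [hst]
        ring
      rw [this, zero_smul]
    · simp only [Matrix.smul_mul, Matrix.mul_smul, Matrix.mul_neg, h5, Matrix.one_mul, smul_smul]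
      rw [add_left_comm, ← neg_smul, ← add_smul]
      congr 2
      field_simp
      rw [hst]
      ring
  have h6 : 1 + t⁻¹ • (D * PD * D.transpose + x ^ 2 • PL) =
      (1 + (x ^ 2 / t) • PL) * (1 + s⁻¹ • (D * PD * D.transpose)) := by
    have h7 : PL * (D * PD * D.transpose) = D * PD * D.transpose := by
      rw [← Matrix.mul_assoc, hLD]
    simp only [Matrix.add_mul, Matrix.mul_add, Matrix.one_mul, Matrix.mul_one, Matrix.smul_mul,
      Matrix.mul_smul, h7, smul_add, smul_smul]
    have h9 : t⁻¹ = s⁻¹ + s⁻¹ * (x ^ 2 / t) := by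
      field_simp
      rw [hst]
    have h10 : t⁻¹ * x ^ 2 = x ^ 2 / t := by rw [div_eq_inv_mul]
    rw [h10]
    nth_rewrite 1 [h9]
    rw [add_smul]
    abel
  have h8 := congrArg Matrix.det h2
  rw [Matrix.det_mul, Matrix.det_fromBlocks_zero₁₂, Matrix.det_fromBlocks_zero₂₁, h6,
    Matrix.det_mul, Matrix.det_one, one_mul, one_mul] at h8
  rw [h1, ← h8, h6]

variable {R : Type*} [Field R] (x : ℕ → R)

/-- The determinant of `1 + t⁻¹ ∂ ∂ᵀ`, for the boundary matrix `∂` with columns in `K` and rows in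
the simplex on `p, …, n`. -/
noncomputable def gramDet (p n : ℕ) (t : R) (K : Finset (Finset ℕ)) : R :=
  (1 + t⁻¹ • (simplexBoundary x p n * faceProjection R p n K *
    (simplexBoundary x p n).transpose)).det

/-- The faces of `K` avoiding `p`, as a family on `p + 1, …, n`. -/
def avoiding (p n : ℕ) (K : Finset (Finset ℕ)) : Finset (Finset ℕ) :=
  (Finset.Icc (p + 1) n).powerset.filter fun F => F ∈ K

/-- The faces `F` with `insert p F ∈ K`, as a family on `p + 1, …, n`. -/
def coavoiding (p n : ℕ) (K : Finset (Finset ℕ)) : Finset (Finset ℕ) :=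
  (Finset.Icc (p + 1) n).powerset.filter fun F => insert p F ∈ K

variable {p n : ℕ} {K : Finset (Finset ℕ)}

theorem IsShiftedOn.avoiding (hK : IsShiftedOn p n K) :
    IsShiftedOn (p + 1) n (avoiding p n K) := by
  refine ⟨fun F hF => Finset.mem_powerset.1 (Finset.mem_filter.1 hF).1, ?_⟩
  intro F hF i hi j hj hij hiF hjF
  obtain ⟨hF, hFK⟩ := Finset.mem_filter.1 hF
  refine Finset.mem_filter.2 ⟨Finset.mem_powerset.2 (Finset.insert_subset hi
    ((Finset.erase_subset j F).trans (Finset.mem_powerset.1 hF))), hK.2 F hFK i ?_ j ?_ hij hiF hjF⟩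
  · exact Finset.Icc_subset_Icc_left (Nat.le_succ p) hi
  · exact Finset.Icc_subset_Icc_left (Nat.le_succ p) hj

theorem IsShiftedOn.coavoiding (hK : IsShiftedOn p n K) :
    IsShiftedOn (p + 1) n (coavoiding p n K) := by
  refine ⟨fun F hF => Finset.mem_powerset.1 (Finset.mem_filter.1 hF).1, ?_⟩
  intro F hF i hi j hj hij hiF hjF
  obtain ⟨hF, hFK⟩ := Finset.mem_filter.1 hF
  have hpi := (Finset.mem_Icc.1 hi).1
  have hpj := (Finset.mem_Icc.1 hj).1
  refine Finset.mem_filter.2 ⟨Finset.mem_powerset.2 (Finset.insert_subset hi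
    ((Finset.erase_subset j F).trans (Finset.mem_powerset.1 hF))), ?_⟩
  have h := hK.2 (insert p F) hFK i (Finset.Icc_subset_Icc_left (Nat.le_succ p) hi) j
    (Finset.Icc_subset_Icc_left (Nat.le_succ p) hj) hij
    (by rw [Finset.mem_insert]; rintro (h | h); exacts [by lia, hiF h])
    (Finset.mem_insert_of_mem hjF)
  rwa [Finset.erase_insert_of_ne (by lia), Finset.insert_comm] at h

theorem familyDegree_eq_add (hK : IsShiftedOn p n K) {v : ℕ} (hv : p < v) :
    familyDegree K v = familyDegree (avoiding p n K) v + familyDegree (coavoiding p n K) v := by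
  rw [familyDegree, ← Finset.card_filter_add_card_filter_not (fun F => p ∉ F), familyDegree,
    familyDegree]
  congr 1
  · congr 1
    ext F
    simp only [avoiding, Finset.mem_filter]
    constructor
    · rintro ⟨⟨hF, hvF⟩, hp⟩
      exact ⟨⟨mem_powerset_Icc_succ (Finset.mem_powerset.2 (hK.1 F hF)) hp, hF⟩, hvF⟩
    · rintro ⟨⟨hF, hFK⟩, hvF⟩
      exact ⟨⟨hFK, hvF⟩, notMem_of_mem_powerset_Icc_succ hF⟩
  · refine Finset.card_bij' (fun F _ => F.erase p) (fun F _ => insert p F) ?_ ?_ ?_ ?_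
    · simp only [coavoiding, Finset.mem_filter, not_not, and_imp]
      intro F hF hvF hp
      exact ⟨⟨erase_mem_powerset_Icc_succ (Finset.mem_powerset.2 (hK.1 F hF)),
        by rwa [Finset.insert_erase hp]⟩, Finset.mem_erase.2 ⟨hv.ne', hvF⟩⟩
    · simp only [coavoiding, Finset.mem_filter, not_not, and_imp]
      intro F _ hFK hvF
      exact ⟨⟨hFK, Finset.mem_insert_of_mem hvF⟩, Finset.mem_insert_self p F⟩
    · intro F hF
      simp only [Finset.mem_filter, not_not] at hF
      exact Finset.insert_erase hF.2
    · intro F hF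
      simp only [coavoiding, Finset.mem_filter] at hF
      exact Finset.erase_insert (notMem_of_mem_powerset_Icc_succ hF.1.1)

theorem familyDegree_self (hK : IsShiftedOn p n K) :
    familyDegree K p = (coavoiding p n K).card := by
  refine Finset.card_bij' (fun F _ => F.erase p) (fun F _ => insert p F) ?_ ?_ ?_ ?_
  · simp only [coavoiding, Finset.mem_filter, and_imp]
    intro F hF hp
    exact ⟨erase_mem_powerset_Icc_succ (Finset.mem_powerset.2 (hK.1 F hF)),
      by rwa [Finset.insert_erase hp]⟩
  · simp only [coavoiding, Finset.mem_filter, and_imp]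
    intro F _ hFK
    exact ⟨hFK, Finset.mem_insert_self p F⟩
  · intro F hF
    exact Finset.insert_erase (Finset.mem_filter.1 hF).2
  · intro F hF
    exact Finset.erase_insert (notMem_of_mem_powerset_Icc_succ (Finset.mem_filter.1 hF).1)

theorem faceProjection_submatrix_simplexSplit (hpn : p ≤ n) (K : Finset (Finset ℕ)) :
    (faceProjection R p n K).submatrix (simplexSplit hpn) (simplexSplit hpn) =
      Matrix.fromBlocks (faceProjection R (p + 1) n (avoiding p n K)) 0 0
        (faceProjection R (p + 1) n (coavoiding p n K)) := by
  rw [faceProjection, Matrix.submatrix_diagonal_equiv, faceProjection, faceProjection,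
    Matrix.fromBlocks_diagonal]
  congr 1
  ext (⟨G, hG⟩ | ⟨G, hG⟩)
  · by_cases h : G ∈ K <;> simp [simplexSplit_inl, avoiding, h]
  · by_cases h : insert p G ∈ K <;>
      simp [simplexSplit_inr, coavoiding, h]

theorem faceProjection_mul_simplexBoundary_mul (hpn : p ≤ n) (hK : IsShiftedOn p n K) :
    faceProjection R (p + 1) n (coavoiding p n K) *
        (simplexBoundary x (p + 1) n * faceProjection R (p + 1) n (avoiding p n K)) =
      simplexBoundary x (p + 1) n * faceProjection R (p + 1) n (avoiding p n K) := by
  ext ⟨G, hG⟩ ⟨F, hF⟩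
  simp only [faceProjection, Matrix.diagonal_mul, Matrix.mul_diagonal, simplexBoundary,
    Matrix.of_apply]
  by_cases hGL : G ∈ coavoiding p n K
  · rw [if_pos hGL, one_mul]
  by_cases hFD : F ∈ avoiding p n K
  swap
  · rw [if_neg hFD]
    simp
  rw [weightedIncidence_eq_zero]
  · simp
  · rintro v hv rfl
    refine hGL (Finset.mem_filter.2 ⟨hG, hK.2 F (Finset.mem_filter.1 hFD).2 p
      (Finset.left_mem_Icc.2 hpn) v ?_ ?_ (notMem_of_mem_powerset_Icc_succ hF) hv⟩)
    · exact Finset.mem_powerset.1 (mem_powerset_Icc_of_succ hF) hv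
    · exact lt_of_mem_powerset_Icc_succ hF hv

theorem det_one_add_smul_faceProjection {c : R} (hK : K ⊆ (Finset.Icc p n).powerset) :
    (1 + c • faceProjection R p n K).det = (1 + c) ^ K.card := by
  rw [faceProjection, ← Matrix.diagonal_one, ← Matrix.diagonal_smul, Matrix.diagonal_add,
    Matrix.det_diagonal]
  simp only [Pi.smul_apply]
  rw [Finset.prod_coe_sort (Finset.Icc p n).powerset
    fun G => (1 : R) + c • if G ∈ K then (1 : R) else 0]
  rw [← Finset.prod_subset hK]
  · rw [Finset.prod_congr rfl (g := fun _ => 1 + c), Finset.prod_const]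
    intro G hG
    simp [hG]
  · intro G _ hG
    simp [hG]

theorem gramDet_succ (hpn : p ≤ n) (hK : IsShiftedOn p n K) {s t : R} (hs : s ≠ 0) (ht : t ≠ 0)
    (hst : s = t + x p ^ 2) :
    gramDet x p n t K = (s / t) ^ familyDegree K p *
      gramDet x (p + 1) n s (avoiding p n K) * gramDet x (p + 1) n s (coavoiding p n K) := by
  have h := det_one_add_smul_fromBlocks (simplexBoundary x (p + 1) n)
    (faceProjection R (p + 1) n (avoiding p n K)) (faceProjection R (p + 1) n (coavoiding p n K))
    (x p) s t hs ht hst (simplexBoundary_mul_self x (p + 1) n)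
    (by simp [faceProjection, Matrix.diagonal_mul_diagonal])
    (faceProjection_mul_simplexBoundary_mul x hpn hK)
  have hL : coavoiding p n K ⊆ (Finset.Icc (p + 1) n).powerset := Finset.filter_subset _ _
  rw [det_one_add_smul_faceProjection hL, ← familyDegree_self hK] at h
  have hc : 1 + x p ^ 2 / t = s / t := by
    field_simp
    rw [hst]
  rw [hc] at h
  rw [gramDet, gramDet, gramDet, ← h, ← simplexBoundary_submatrix_simplexSplit x hpn,
    ← faceProjection_submatrix_simplexSplit hpn, Matrix.submatrix_mul_equiv,
    Matrix.transpose_submatrix, Matrix.submatrix_mul_equiv,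
    ← Matrix.det_submatrix_equiv_self (simplexSplit hpn)]
  congr 1
  ext i j
  simp [Matrix.one_apply]

/-- The weighted Gram determinant of a shifted family is determined by its degree sequence. -/
theorem gramDet_eq_prod {g : ℕ → R} (hg : ∀ v, p ≤ v → g v ≠ 0)
    (hgx : ∀ v, p ≤ v → g (v + 1) = g v + x v ^ 2) (hK : IsShiftedOn p n K) :
    gramDet x p n (g p) K = ∏ v ∈ Finset.Icc p n, (g (v + 1) / g v) ^ familyDegree K v := by
  induction hm : n + 1 - p generalizing p K with
  | zero =>
    have hD : simplexBoundary x p n = 0 := by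
      ext ⟨G, hG⟩ ⟨F, hF⟩
      have hF' : F = ∅ := by
        rwa [Finset.Icc_eq_empty (by lia), Finset.powerset_empty, Finset.mem_singleton] at hF
      simp [simplexBoundary, weightedIncidence, hF']
    rw [gramDet, hD, Finset.prod_eq_one fun v hv => absurd (Finset.mem_Icc.1 hv) (by lia)]
    simp
  | succ m ih =>
    have hpn : p ≤ n := by lia
    have hg' : ∀ v, p + 1 ≤ v → g v ≠ 0 := fun v hv => hg v (by lia)
    have hgx' : ∀ v, p + 1 ≤ v → g (v + 1) = g v + x v ^ 2 := fun v hv => hgx v (by lia)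
    rw [gramDet_succ x hpn hK (hg (p + 1) (by lia)) (hg p le_rfl) (hgx p le_rfl),
      ih hg' hgx' hK.avoiding (by lia), ih hg' hgx' hK.coavoiding (by lia), mul_assoc,
      ← Finset.prod_mul_distrib, ← Finset.insert_Icc_succ_left_eq_Icc hpn,
      Finset.prod_insert (by simp)]
    congr 1
    refine Finset.prod_congr rfl fun v hv => ?_
    rw [← pow_add, ← familyDegree_eq_add hK (Finset.mem_Icc.1 hv).1]

/-- The Gram determinant may be computed with any set of rows containing all facets of the members
of `K`. -/
theorem gramDet_eq_det {N : Finset (Finset ℕ)} (t : R) (hK : K ⊆ (Finset.Icc p n).powerset)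
    (hN : ∀ F ∈ K, ∀ v ∈ F, F.erase v ∈ N) :
    gramDet x p n t K = (1 + t⁻¹ • Matrix.of fun G G' : N =>
      ∑ F ∈ K, weightedIncidence x G.1 F * weightedIncidence x G'.1 F).det := by
  have aux : ∀ B : Finset (Finset ℕ), (∀ F ∈ K, ∀ v ∈ F, F.erase v ∈ B) →
      (1 + t⁻¹ • Matrix.of fun G G' : B =>
        ∑ F ∈ K, weightedIncidence x G.1 F * weightedIncidence x G'.1 F).det =
      (1 + t⁻¹ • Matrix.of fun F F' : K => ∑ v ∈ F.1,
        (faceSign v F.1 : R) * x v * weightedIncidence x (F.1.erase v) F'.1).det := by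
    intro B hB
    let M : Matrix B K R := Matrix.of fun G F => weightedIncidence x G.1 F.1
    have h1 : (Matrix.of fun G G' : B =>
        ∑ F ∈ K, weightedIncidence x G.1 F * weightedIncidence x G'.1 F) = M * M.transpose := by
      ext G G'
      rw [Matrix.mul_apply, Matrix.of_apply, ← Finset.sum_coe_sort K]
      rfl
    have h2 : (Matrix.of fun F F' : K => ∑ v ∈ F.1,
        (faceSign v F.1 : R) * x v * weightedIncidence x (F.1.erase v) F'.1) =
        M.transpose * M := by
      ext F F'
      rw [Matrix.mul_apply, Matrix.of_apply, ← sum_weightedIncidence_mul x (hB F.1 F.2)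
        fun G => weightedIncidence x G F'.1, ← Finset.sum_coe_sort B]
      rfl
    rw [h1, h2, ← Matrix.smul_mul, Matrix.det_one_add_mul_comm, Matrix.mul_smul]
  have hP : ∀ F ∈ K, ∀ v ∈ F, F.erase v ∈ (Finset.Icc p n).powerset := fun F hF v _ =>
    Finset.mem_powerset.2 ((Finset.erase_subset v F).trans (Finset.mem_powerset.1 (hK hF)))
  rw [aux N hN, ← aux _ hP, gramDet]
  congr 3
  ext G G'
  rw [Matrix.mul_apply, Matrix.of_apply]
  simp only [faceProjection, Matrix.mul_diagonal, simplexBoundary, Matrix.of_apply,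
    Matrix.transpose_apply]
  rw [Finset.sum_coe_sort (Finset.Icc p n).powerset fun F => weightedIncidence x G.1 F *
    (if F ∈ K then (1 : R) else 0) * weightedIncidence x G'.1 F]
  rw [← Finset.sum_subset hK]
  · exact Finset.sum_congr rfl fun F hF => by simp [hF]
  · intro F _ hF
    simp [hF]

end GramDeterminant

section Homology

theorem mem_facesOfDim {S : Finset (Finset ℕ)} {i : ℤ} {F : Finset ℕ} :
    F ∈ facesOfDim S i ↔ F ∈ S ∧ (F.card : ℤ) = i + 1 :=
  Finset.mem_filter

/-- The `i`-dimensional faces of `S` avoiding the vertex `p`. -/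
def facesAvoiding (p : ℕ) (S : Finset (Finset ℕ)) (i : ℤ) : Finset (Finset ℕ) :=
  (facesOfDim S i).filter fun F => p ∉ F

theorem mem_facesAvoiding {p : ℕ} {S : Finset (Finset ℕ)} {i : ℤ} {F : Finset ℕ} :
    F ∈ facesAvoiding p S i ↔ (F ∈ S ∧ (F.card : ℤ) = i + 1) ∧ p ∉ F := by
  rw [facesAvoiding, Finset.mem_filter, mem_facesOfDim]

variable {p : ℕ} {T : Finset (Finset ℕ)} {i j k : ℤ}

theorem boundary_apply (c : Chains T i) (G : {G // G ∈ facesOfDim T j}) :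
    boundary T i j c G = ∑ F, weightedIncidence (1 : ℕ → ℤ) G.1 F.1 * c F := by
  simp [boundary, Matrix.mulVec, dotProduct, boundaryMatrix, weightedIncidence]

theorem erase_mem_facesOfDim (hT : IsComplex T) (hij : i = j + 1) {F : Finset ℕ}
    (hF : F ∈ facesOfDim T i) {v : ℕ} (hv : v ∈ F) : F.erase v ∈ facesOfDim T j := by
  rw [mem_facesOfDim] at hF ⊢
  refine ⟨hT.2 F hF.1 _ (Finset.erase_subset v F), ?_⟩
  have := Finset.card_erase_add_one hv
  lia

theorem boundary_boundary (hT : IsComplex T) (hij : i = j + 1) (c : Chains T i) :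
    boundary T j k (boundary T i j c) = 0 := by
  ext H
  simp only [boundary_apply, Finset.mul_sum, Pi.zero_apply]
  rw [Finset.sum_comm]
  refine Finset.sum_eq_zero fun F _ => ?_
  simp only [← mul_assoc]
  rw [← Finset.sum_mul, Finset.sum_coe_sort (facesOfDim T j)
    fun G => weightedIncidence (1 : ℕ → ℤ) H.1 G * weightedIncidence (1 : ℕ → ℤ) G F.1,
    sum_weightedIncidence_mul_weightedIncidence _
      (fun v hv => erase_mem_facesOfDim hT hij F.2 hv), zero_mul]

/-- The restriction of chains to the faces avoiding `p`. -/
def restrictAvoiding (p : ℕ) (T : Finset (Finset ℕ)) (j : ℤ) :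
    Chains T j →ₗ[ℤ] ({G // G ∈ facesAvoiding p T j} → ℤ) :=
  LinearMap.funLeft ℤ ℤ fun G => ⟨G.1, (Finset.mem_filter.1 G.2).1⟩

theorem eq_zero_of_restrictAvoiding_eq_zero (hT : IsComplex T) (hp : ∀ F ∈ T, ∀ v ∈ F, p ≤ v)
    (hjk : j = k + 1) {z : Chains T j} (hz : boundary T j k z = 0)
    (hres : restrictAvoiding p T j z = 0) : z = 0 := by
  have h0 : ∀ F : {F // F ∈ facesOfDim T j}, p ∉ F.1 → z F = 0 := fun F hF =>
    congrFun hres ⟨F.1, Finset.mem_filter.2 ⟨F.2, hF⟩⟩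
  ext F
  rw [Pi.zero_apply]
  by_cases hpF : p ∈ F.1
  swap
  · exact h0 F hpF
  have h := congrFun hz ⟨F.1.erase p, erase_mem_facesOfDim hT hjk F.2 hpF⟩
  rw [boundary_apply, Pi.zero_apply, Finset.sum_eq_single F] at h
  · have hlt : ∀ v ∈ F.1.erase p, p < v := fun v hv =>
      lt_of_le_of_ne (hp F.1 (mem_facesOfDim.1 F.2).1 v (Finset.mem_of_mem_erase hv))
        (Finset.ne_of_mem_erase hv).symm
    have h1 := weightedIncidence_insert_right (1 : ℕ → ℤ) hlt (Finset.notMem_erase p F.1)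
    rw [Finset.insert_erase hpF, if_pos rfl] at h1
    simpa [h1] using h
  · intro F' _ hne
    by_cases hpF' : p ∈ F'.1
    · rw [weightedIncidence_eq_zero, zero_mul]
      intro v hv hvF
      have hvp : v = p := by
        by_contra hvp
        exact Finset.notMem_erase p F.1
          ((show F'.1.erase v = F.1.erase p from hvF) ▸ Finset.mem_erase.2 ⟨Ne.symm hvp, hpF'⟩)
      subst hvp
      exact hne (Subtype.ext (by rw [← Finset.insert_erase hpF', hvF, Finset.insert_erase hpF]))
    · rw [h0 F' hpF', mul_zero]
  · simp

/-- The combination of the boundaries of the cones `insert p G` with coefficients `y`. -/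
def coneCycle (p : ℕ) (T : Finset (Finset ℕ)) (j : ℤ)
    (y : {G // G ∈ facesAvoiding p T j} → ℤ) : Chains T j :=
  fun F => ∑ G, weightedIncidence (1 : ℕ → ℤ) F.1 (insert p G.1) * y G

theorem lt_of_mem_facesAvoiding (hp : ∀ F ∈ T, ∀ v ∈ F, p ≤ v) {G : Finset ℕ}
    (hG : G ∈ facesAvoiding p T j) {v : ℕ} (hv : v ∈ G) : p < v := by
  rw [mem_facesAvoiding] at hG
  exact lt_of_le_of_ne (hp G hG.1.1 v hv) fun h => hG.2 (h ▸ hv)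

theorem restrictAvoiding_coneCycle (hp : ∀ F ∈ T, ∀ v ∈ F, p ≤ v)
    (y : {G // G ∈ facesAvoiding p T j} → ℤ) :
    restrictAvoiding p T j (coneCycle p T j y) = y := by
  ext G
  change ∑ G', weightedIncidence (1 : ℕ → ℤ) G.1 (insert p G'.1) * y G' = y G
  rw [Finset.sum_eq_single G]
  · rw [weightedIncidence_insert_right _ (fun v hv => lt_of_mem_facesAvoiding hp G.2 hv)
      (mem_facesAvoiding.1 G.2).2]
    simp
  · intro G' _ hne
    rw [weightedIncidence_insert_right _ (fun v hv => lt_of_mem_facesAvoiding hp G'.2 hv)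
      (mem_facesAvoiding.1 G.2).2, if_neg fun h => hne (Subtype.ext h.symm), zero_mul]
  · simp

theorem boundary_coneCycle
    (hcone : ∀ G ∈ facesAvoiding p T j, ∀ v ∈ G, insert p (G.erase v) ∈ T)
    (y : {G // G ∈ facesAvoiding p T j} → ℤ) : boundary T j k (coneCycle p T j y) = 0 := by
  ext H
  simp only [boundary_apply, coneCycle, Finset.mul_sum, Pi.zero_apply]
  rw [Finset.sum_comm]
  refine Finset.sum_eq_zero fun G _ => ?_
  simp only [← mul_assoc]
  rw [← Finset.sum_mul, Finset.sum_coe_sort (facesOfDim T j)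
    fun F => weightedIncidence (1 : ℕ → ℤ) H.1 F * weightedIncidence (1 : ℕ → ℤ) F (insert p G.1),
    sum_weightedIncidence_mul_weightedIncidence, zero_mul]
  have hG := mem_facesAvoiding.1 G.2
  intro v hv
  by_cases hvp : v = p
  · rw [hvp, Finset.erase_insert hG.2]
    exact (Finset.mem_filter.1 G.2).1
  · have hvG := (Finset.mem_insert.1 hv).resolve_left hvp
    rw [Finset.erase_insert_of_ne (Ne.symm hvp), mem_facesOfDim]
    refine ⟨hcone G.1 G.2 v hvG, ?_⟩
    rw [Finset.card_insert_of_notMem fun h => hG.2 (Finset.mem_of_mem_erase h),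
      Finset.card_erase_add_one hvG, hG.1.2]

/-- Cycles are determined by their coefficients at the faces avoiding `p`, which are arbitrary. -/
noncomputable def cycleEquiv (hT : IsComplex T) (hp : ∀ F ∈ T, ∀ v ∈ F, p ≤ v) (hjk : j = k + 1)
    (hcone : ∀ G ∈ facesAvoiding p T j, ∀ v ∈ G, insert p (G.erase v) ∈ T) :
    LinearMap.ker (boundary T j k) ≃ₗ[ℤ] ({G // G ∈ facesAvoiding p T j} → ℤ) :=
  LinearEquiv.ofBijective ((restrictAvoiding p T j).comp (LinearMap.ker (boundary T j k)).subtype)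
    ⟨(injective_iff_map_eq_zero _).2 fun z hz =>
      Subtype.ext (eq_zero_of_restrictAvoiding_eq_zero hT hp hjk z.2 hz),
    fun y => ⟨⟨coneCycle p T j y, boundary_coneCycle hcone y⟩, restrictAvoiding_coneCycle hp y⟩⟩

/-- The rows of the boundary matrix indexed by the faces avoiding `p`. -/
def reducedBoundary (p : ℕ) (T : Finset (Finset ℕ)) (i j : ℤ) :
    Matrix {G // G ∈ facesAvoiding p T j} {F // F ∈ facesOfDim T i} ℤ :=
  Matrix.of fun G F => weightedIncidence (1 : ℕ → ℤ) G.1 F.1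

theorem restrictAvoiding_boundary (c : Chains T i) :
    restrictAvoiding p T j (boundary T i j c) = (reducedBoundary p T i j).mulVec c := by
  ext G
  change boundary T i j c ⟨G.1, _⟩ = _
  rw [boundary_apply]
  rfl

theorem boundary_eq_zero_iff (hT : IsComplex T) (hp : ∀ F ∈ T, ∀ v ∈ F, p ≤ v)
    (hij : i = j + 1) (c : Chains T i) :
    boundary T i j c = 0 ↔ (reducedBoundary p T i j).mulVec c = 0 := by
  rw [← restrictAvoiding_boundary]
  refine ⟨fun h => by rw [h, map_zero], fun h => ?_⟩
  exact eq_zero_of_restrictAvoiding_eq_zero hT hp (k := j - 1) (by ring)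
    (boundary_boundary hT hij c) h

/-- Homology is the cokernel of the reduced boundary matrix. -/
noncomputable def homologyEquiv (hT : IsComplex T) (hp : ∀ F ∈ T, ∀ v ∈ F, p ≤ v)
    (hij : i = j + 1) (hjk : j = k + 1)
    (hcone : ∀ G ∈ facesAvoiding p T j, ∀ v ∈ G, insert p (G.erase v) ∈ T) :
    (LinearMap.ker (boundary T j k) ⧸
        (LinearMap.range (boundary T i j)).submoduleOf (LinearMap.ker (boundary T j k))) ≃ₗ[ℤ]
      (({G // G ∈ facesAvoiding p T j} → ℤ) ⧸
        LinearMap.range (reducedBoundary p T i j).mulVecLin) :=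
  Submodule.Quotient.equiv _ _ (cycleEquiv hT hp hjk hcone) (by
    ext y
    constructor
    · rintro ⟨z, ⟨c, hc⟩, rfl⟩
      refine ⟨c, ?_⟩
      rw [Matrix.mulVecLin_apply, ← restrictAvoiding_boundary, hc]
      rfl
    · rintro ⟨c, rfl⟩
      refine ⟨⟨boundary T i j c, boundary_boundary hT hij c⟩, ⟨c, rfl⟩, ?_⟩
      exact restrictAvoiding_boundary c)

theorem natCard_quotient_range_mulVecLin {m n : Type*} [Fintype m] [DecidableEq m] [Fintype n]
    (M : Matrix m n ℤ) (e : m ≃ n) (h : (M.submatrix id e).det ≠ 0) :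
    Nat.card ((m → ℤ) ⧸ LinearMap.range M.mulVecLin) = (M.submatrix id e).det.natAbs := by
  have hrange : LinearMap.range M.mulVecLin = LinearMap.range (M.submatrix id e).mulVecLin := by
    ext y
    constructor
    · rintro ⟨c, rfl⟩
      refine ⟨c ∘ e, ?_⟩
      have := Matrix.submatrix_mulVec_equiv M (c ∘ e) id e
      simpa [Function.comp_assoc] using this
    · rintro ⟨c, rfl⟩
      refine ⟨c ∘ e.symm, ?_⟩
      have := Matrix.submatrix_mulVec_equiv M c id e
      simpa using this.symm
  have hinj : Function.Injective (M.submatrix id e).mulVecLin := by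
    rw [injective_iff_map_eq_zero]
    intro c hc
    by_contra hne
    exact h (Matrix.exists_mulVec_eq_zero_iff.1 ⟨c, hne, hc⟩)
  rw [hrange]
  have key := Submodule.natAbs_det_equiv (LinearMap.range (M.submatrix id e).mulVecLin)
    (LinearEquiv.ofInjective _ hinj)
  rw [← key]
  congr 1
  have : (LinearMap.range (M.submatrix id e).mulVecLin).subtype ∘ₗ
      AddMonoidHom.toIntLinearMap
        ((LinearEquiv.ofInjective _ hinj : (m → ℤ) ≃ₗ[ℤ] _) : (m → ℤ) →+ _) =
      Matrix.toLin' (M.submatrix id e) := by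
    ext
    rfl
  rw [this, LinearMap.det_toLin']

theorem natCard_homology (hT : IsComplex T) (hp : ∀ F ∈ T, ∀ v ∈ F, p ≤ v)
    (hij : i = j + 1) (hjk : j = k + 1)
    (hcone : ∀ G ∈ facesAvoiding p T j, ∀ v ∈ G, insert p (G.erase v) ∈ T)
    (e : {G // G ∈ facesAvoiding p T j} ≃ {F // F ∈ facesOfDim T i})
    (h : ((reducedBoundary p T i j).submatrix id e).det ≠ 0) :
    Nat.card (LinearMap.ker (boundary T j k) ⧸
        (LinearMap.range (boundary T i j)).submoduleOf (LinearMap.ker (boundary T j k))) =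
      ((reducedBoundary p T i j).submatrix id e).det.natAbs := by
  rw [← natCard_quotient_range_mulVecLin _ e h]
  exact Nat.card_congr (homologyEquiv hT hp hij hjk hcone).toEquiv

theorem range_boundary_eq_bot (h : facesOfDim T i = ∅) : LinearMap.range (boundary T i j) = ⊥ := by
  have : IsEmpty {F // F ∈ facesOfDim T i} := ⟨fun F => by simpa [h] using F.2⟩
  rw [LinearMap.range_eq_bot]
  ext c
  exact isEmptyElim c

/-- The top homology group vanishes exactly when the reduced boundary matrix is injective. -/
theorem subsingleton_redHomology_iff (hT : IsComplex T) (hp : ∀ F ∈ T, ∀ v ∈ F, p ≤ v)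
    (htop : facesOfDim T (i + 1) = ∅) :
    Subsingleton (RedHomology T i) ↔
      ∀ c, (reducedBoundary p T i (i - 1)).mulVec c = 0 → c = 0 := by
  rw [Submodule.Quotient.subsingleton_iff, range_boundary_eq_bot htop]
  constructor
  · intro h c hc
    rw [← boundary_eq_zero_iff hT hp (by ring)] at hc
    have hmem : (⟨c, hc⟩ : LinearMap.ker (boundary T i (i - 1))) ∈
        (⊥ : Submodule ℤ (Chains T i)).submoduleOf (LinearMap.ker (boundary T i (i - 1))) :=
      h ▸ Submodule.mem_top
    exact hmem
  · intro h
    rw [eq_top_iff]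
    rintro ⟨c, hc⟩ -
    exact h c ((boundary_eq_zero_iff hT hp (by ring) c).1 hc)

theorem reducedBoundary_mulVec_surjective (hp : ∀ F ∈ T, ∀ v ∈ F, p ≤ v)
    (hcone : ∀ G ∈ facesAvoiding p T j, insert p G ∈ facesOfDim T i) :
    Function.Surjective (reducedBoundary p T i j).mulVecLin := by
  intro y
  refine ⟨∑ G, y G • Pi.single ⟨insert p G.1, hcone G.1 G.2⟩ 1, ?_⟩
  rw [map_sum]
  ext G'
  simp only [map_smul, Matrix.mulVecLin_apply, Matrix.mulVec_single_one, Finset.sum_apply,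
    Pi.smul_apply, smul_eq_mul]
  rw [Finset.sum_eq_single G']
  · change y G' * weightedIncidence (1 : ℕ → ℤ) G'.1 (insert p G'.1) = y G'
    rw [weightedIncidence_insert_right _ (fun v hv => lt_of_mem_facesAvoiding hp G'.2 hv)
      (mem_facesAvoiding.1 G'.2).2]
    simp
  · intro G _ hne
    change y G * weightedIncidence (1 : ℕ → ℤ) G'.1 (insert p G.1) = 0
    rw [weightedIncidence_insert_right _ (fun v hv => lt_of_mem_facesAvoiding hp G.2 hv)
      (mem_facesAvoiding.1 G'.2).2, if_neg fun h => hne (Subtype.ext h.symm), mul_zero]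
  · simp

theorem redBetti_add_card (hT : IsComplex T) (hp : ∀ F ∈ T, ∀ v ∈ F, p ≤ v)
    (htop : facesOfDim T (i + 1) = ∅)
    (hcone : ∀ G ∈ facesAvoiding p T (i - 1), insert p G ∈ facesOfDim T i) :
    redBetti T i + (facesAvoiding p T (i - 1)).card = (facesOfDim T i).card := by
  have hker : LinearMap.ker (boundary T i (i - 1)) =
      LinearMap.ker (reducedBoundary p T i (i - 1)).mulVecLin := by
    ext c
    exact boundary_eq_zero_iff hT hp (by ring) c
  have hbot : (LinearMap.range (boundary T (i + 1) i)).submoduleOf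
      (LinearMap.ker (boundary T i (i - 1))) = ⊥ := by
    rw [range_boundary_eq_bot htop]
    exact LinearMap.ker_eq_bot.2 (Submodule.injective_subtype _)
  have hrank := Submodule.finrank_quotient_add_finrank
    (LinearMap.ker (reducedBoundary p T i (i - 1)).mulVecLin)
  rw [(LinearMap.quotKerEquivRange _).finrank_eq,
    LinearMap.range_eq_top.2 (reducedBoundary_mulVec_surjective hp hcone), finrank_top,
    Module.finrank_fintype_fun_eq_card, Module.finrank_fintype_fun_eq_card, Fintype.card_coe,
    Fintype.card_coe] at hrank
  rw [redBetti, (Submodule.quotEquivOfEqBot _ hbot).finrank_eq, hker, ← hrank, add_comm]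

theorem insert_mem_of_redBetti_eq_zero {n : ℕ} (hshift : IsShiftedOn p n T)
    (hpn : p ≤ n) (h : redBetti T j = 0) {G : Finset ℕ} (hG : G ∈ facesAvoiding p T j) :
    insert p G ∈ T := by
  by_contra hins
  have hp : ∀ F ∈ T, ∀ v ∈ F, p ≤ v := fun F hF v hv => (Finset.mem_Icc.1 (hshift.1 F hF hv)).1
  have hcone : ∀ G ∈ facesAvoiding p T j, ∀ v ∈ G, insert p (G.erase v) ∈ T := fun G hG v hv =>
    hshift.2 G (mem_facesAvoiding.1 hG).1.1 p (Finset.left_mem_Icc.2 hpn) v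
      (hshift.1 G (mem_facesAvoiding.1 hG).1.1 hv) (lt_of_mem_facesAvoiding hp hG hv)
      (mem_facesAvoiding.1 hG).2 hv
  let y : {G // G ∈ facesAvoiding p T j} → ℤ := Pi.single ⟨G, hG⟩ 1
  let z : LinearMap.ker (boundary T j (j - 1)) := ⟨coneCycle p T j y, boundary_coneCycle hcone y⟩
  obtain ⟨a, ha, haz⟩ := Module.finrank_eq_zero_iff.1 h (Submodule.Quotient.mk z)
  rw [← Submodule.Quotient.mk_smul, Submodule.Quotient.mk_eq_zero] at haz
  obtain ⟨c, hc⟩ := haz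
  have h1 := congrArg (restrictAvoiding p T j) hc
  rw [restrictAvoiding_boundary] at h1
  have h2 := congrFun h1 ⟨G, hG⟩
  have h3 : restrictAvoiding p T j (((LinearMap.ker (boundary T j (j - 1))).subtype (a • z))) =
      a • y := by
    rw [map_smul, map_smul]
    exact congrArg (a • ·) (restrictAvoiding_coneCycle hp y)
  rw [h3] at h2
  have h4 : (reducedBoundary p T (j + 1) j).mulVec c ⟨G, hG⟩ = 0 := by
    refine Finset.sum_eq_zero fun F _ => ?_
    change weightedIncidence (1 : ℕ → ℤ) G F.1 * c F = 0
    rw [weightedIncidence_eq_zero, zero_mul]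
    rintro v hv rfl
    have hFT := (mem_facesOfDim.1 F.2).1
    have hpF := (mem_facesAvoiding.1 hG).2
    by_cases hvp : v = p
    · subst hvp
      exact hins (by rwa [Finset.insert_erase hv])
    · refine hins (hshift.2 F.1 hFT p (Finset.left_mem_Icc.2 hpn) v (hshift.1 F.1 hFT hv) ?_ ?_ hv)
      · exact lt_of_le_of_ne (hp F.1 hFT v hv) (Ne.symm hvp)
      · exact fun hpF' => hpF (Finset.mem_erase.2 ⟨Ne.symm hvp, hpF'⟩)
  rw [h4] at h2
  exact ha (by simpa [y] using h2.symm)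

end Homology

section Degrees

theorem prod_pow_familyDegree {R : Type*} [CommMonoid R] {V : Finset ℕ} {K : Finset (Finset ℕ)}
    (hK : ∀ F ∈ K, F ⊆ V) (f : ℕ → R) :
    ∏ v ∈ V, f v ^ familyDegree K v = ∏ F ∈ K, ∏ v ∈ F, f v := by
  have h : ∀ F ∈ K, ∏ v ∈ F, f v = ∏ v ∈ V, if v ∈ F then f v else 1 := by
    intro F hF
    rw [Finset.prod_ite_mem, Finset.inter_eq_right.2 (hK F hF)]
  rw [Finset.prod_congr rfl h, Finset.prod_comm]
  refine Finset.prod_congr rfl fun v _ => ?_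
  rw [← Finset.prod_filter, Finset.prod_const, familyDegree]

theorem IsShiftedOn.familyDegree_le {p n : ℕ} {K : Finset (Finset ℕ)} (hK : IsShiftedOn p n K)
    {v w : ℕ} (hv : v ∈ Finset.Icc p n) (hw : w ∈ Finset.Icc p n) (hvw : v < w) :
    familyDegree K w ≤ familyDegree K v := by
  refine Finset.card_le_card_of_injOn
    (fun F => if v ∈ F then F else insert v (F.erase w)) ?_ ?_
  · intro F hF
    obtain ⟨hF, hwF⟩ := Finset.mem_filter.1 hF
    by_cases h : v ∈ F
    · simp [h, hF]
    · simp [h, hK.2 F hF v hv w hw hvw h hwF]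
  · intro F hF G hG hFG
    have hwF := (Finset.mem_filter.1 hF).2
    have hwG := (Finset.mem_filter.1 hG).2
    by_cases hvF : v ∈ F <;> by_cases hvG : v ∈ G <;>
      simp only [hvF, hvG, if_true, if_false] at hFG
    · exact hFG
    · rw [hFG] at hwF
      simp [hvw.ne'] at hwF
    · rw [← hFG] at hwG
      simp [hvw.ne'] at hwG
    · rw [← Finset.insert_erase hwF, ← Finset.insert_erase hwG]
      congr 1
      rw [← Finset.erase_insert (a := v) (s := F.erase w) (by simp [hvF]), hFG,
        Finset.erase_insert (by simp [hvG])]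

theorem filter_le_eq_Icc_conjPart {n : ℕ} {l : ℕ → ℕ}
    (hl : ∀ v ∈ Finset.Icc 1 n, ∀ w ∈ Finset.Icc 1 n, v < w → l w ≤ l v) (i : ℕ) :
    (Finset.Icc 1 n).filter (fun v => i ≤ l v) = Finset.Icc 1 (conjPart n l i) := by
  have hsub : ∀ v ∈ (Finset.Icc 1 n).filter (fun v => i ≤ l v),
      Finset.Icc 1 v ⊆ (Finset.Icc 1 n).filter (fun v => i ≤ l v) := by
    intro v hv w hw
    rw [Finset.mem_filter] at hv ⊢
    have hv1 := Finset.mem_Icc.1 hv.1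
    have hw1 := Finset.mem_Icc.1 hw
    have hwn : w ∈ Finset.Icc 1 n := Finset.mem_Icc.2 ⟨hw1.1, hw1.2.trans hv1.2⟩
    refine ⟨hwn, ?_⟩
    rcases hw1.2.eq_or_lt with rfl | hlt
    · exact hv.2
    · exact hv.2.trans (hl w hwn v hv.1 hlt)
  refine Finset.eq_of_subset_of_card_le ?_ (by simp [conjPart])
  intro v hv
  have h := Finset.card_le_card (hsub v hv)
  rw [Nat.card_Icc, Nat.add_sub_cancel] at h
  exact Finset.mem_Icc.2 ⟨(Finset.mem_Icc.1 (Finset.mem_filter.1 hv).1).1, h⟩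

theorem prod_Icc_two_div {R : Type*} [Field R] {g : ℕ → R} (hg : ∀ v, 2 ≤ v → g v ≠ 0) {m : ℕ}
    (hm : 1 ≤ m) : ∏ v ∈ Finset.Icc 2 m, g (v + 1) / g v = g (m + 1) / g 2 := by
  induction m, hm using Nat.le_induction with
  | base => simp [hg 2 le_rfl]
  | succ m hm ih =>
    rw [Finset.prod_Icc_succ_top (by lia), ih, mul_comm,
      div_mul_div_cancel₀ (hg (m + 1) (by lia))]

/-- The product over the parts of the conjugate partition, in terms of the partition itself. -/
theorem prod_conjPart {R : Type*} [Field R] {g : ℕ → R} (hg : ∀ v, 2 ≤ v → g v ≠ 0) {n : ℕ}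
    {l : ℕ → ℕ} (hl : ∀ v ∈ Finset.Icc 1 n, ∀ w ∈ Finset.Icc 1 n, v < w → l w ≤ l v) :
    ∏ i ∈ Finset.Icc 1 (conjLength n l), g (conjPart n l i + 1) / g 2 =
      ∏ v ∈ Finset.Icc 2 n, (g (v + 1) / g v) ^ l v := by
  have h : ∀ i ∈ Finset.Icc 1 (conjLength n l), g (conjPart n l i + 1) / g 2 =
      ∏ v ∈ Finset.Icc 2 n, if i ≤ l v then g (v + 1) / g v else 1 := by
    intro i hi
    have hfilter := filter_le_eq_Icc_conjPart hl i
    have hpos : 1 ≤ conjPart n l i := by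
      rw [conjPart, Nat.one_le_iff_ne_zero, Finset.card_ne_zero]
      by_contra hempty
      rw [Finset.not_nonempty_iff_eq_empty, Finset.filter_eq_empty_iff] at hempty
      rw [Finset.mem_Icc] at hi
      have : conjLength n l < i :=
        (Finset.sup_lt_iff (show (⊥ : ℕ) < i from hi.1)).2 fun v hv => not_le.1 (hempty hv)
      lia
    rw [← prod_Icc_two_div hg hpos, ← Finset.prod_filter]
    refine Finset.prod_congr ?_ fun _ _ => rfl
    ext v
    have := Finset.ext_iff.1 hfilter v
    simp only [Finset.mem_filter, Finset.mem_Icc] at this ⊢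
    constructor
    · intro hv
      have := this.2 ⟨by lia, hv.2⟩
      exact ⟨⟨hv.1, this.1.2⟩, this.2⟩
    · intro hv
      exact ⟨hv.1.1, (this.1 ⟨⟨by lia, hv.1.2⟩, hv.2⟩).2⟩
  rw [Finset.prod_congr rfl h, Finset.prod_comm]
  refine Finset.prod_congr rfl fun v hv => ?_
  rw [← Finset.prod_filter, Finset.prod_const]
  congr 1
  have hle : l v ≤ conjLength n l :=
    Finset.le_sup (Finset.Icc_subset_Icc_left (by lia) hv)
  have : (Finset.Icc 1 (conjLength n l)).filter (fun i => i ≤ l v) = Finset.Icc 1 (l v) := by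
    ext i
    simp only [Finset.mem_filter, Finset.mem_Icc]
    lia
  rw [this, Nat.card_Icc, Nat.add_sub_cancel]

end Degrees

section ShiftedComplex

variable {n : ℕ} {d : ℤ} {S : Finset (Finset ℕ)}

theorem facesOfDim_succ_eq_empty (hdim : HasDim S d) : facesOfDim S (d + 1) = ∅ := by
  refine Finset.eq_empty_of_forall_notMem fun F hF => ?_
  rw [mem_facesOfDim] at hF
  have := hdim.2 F hF.1
  lia

theorem mem_link {p : ℕ} {F : Finset ℕ} : F ∈ link p S ↔ p ∉ F ∧ insert p F ∈ S := by
  rw [link, Finset.mem_filter, and_iff_right_iff_imp]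
  rintro ⟨hp, hF⟩
  exact Finset.mem_image.2 ⟨_, hF, Finset.erase_insert hp⟩

theorem mem_deletion {p : ℕ} (hS : IsComplex S) {F : Finset ℕ} :
    F ∈ deletion p S ↔ p ∉ F ∧ F ∈ S := by
  rw [deletion, Finset.mem_image]
  constructor
  · rintro ⟨G, hG, rfl⟩
    exact ⟨Finset.notMem_erase p G, hS.2 G hG _ (Finset.erase_subset p G)⟩
  · rintro ⟨hp, hF⟩
    exact ⟨F, hF, Finset.erase_eq_of_notMem hp⟩

theorem mem_facesOfDim_cone_iff {p : ℕ} {L : Finset (Finset ℕ)} (hL : ∀ F ∈ L, p ∉ F)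
    (hcard : ∀ F ∈ L, (F.card : ℤ) ≤ d) {F : Finset ℕ} :
    F ∈ facesOfDim (cone p L) d ↔ ∃ G ∈ L, (G.card : ℤ) = d ∧ insert p G = F := by
  rw [mem_facesOfDim, cone, Finset.mem_union, Finset.mem_image]
  constructor
  · rintro ⟨hF | ⟨G, hG, rfl⟩, hF'⟩
    · have := hcard F hF
      lia
    · rw [Finset.card_insert_of_notMem (hL G hG)] at hF'
      exact ⟨G, hG, by lia, rfl⟩
  · rintro ⟨G, hG, hG', rfl⟩
    refine ⟨Or.inr ⟨G, hG, rfl⟩, ?_⟩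
    rw [Finset.card_insert_of_notMem (hL G hG)]
    lia

theorem facesOfDim_cone_link {p : ℕ} (hS : IsComplex S) (hdim : HasDim S d)
    (hins : ∀ G ∈ facesAvoiding p S (d - 1), insert p G ∈ S) :
    facesOfDim (cone p (link p S)) d = (facesAvoiding p S (d - 1)).image (insert p) := by
  ext F
  rw [mem_facesOfDim_cone_iff (fun G hG => (mem_link.1 hG).1), Finset.mem_image]
  · refine exists_congr fun G => ?_
    rw [mem_link, mem_facesAvoiding]
    constructor
    · rintro ⟨⟨hp, hG⟩, hcard, rfl⟩
      exact ⟨⟨⟨hS.2 _ hG _ (Finset.subset_insert p G), by lia⟩, hp⟩, rfl⟩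
    · rintro ⟨hG, rfl⟩
      exact ⟨⟨hG.2, hins G (mem_facesAvoiding.2 hG)⟩, by lia, rfl⟩
  · intro G hG
    rw [mem_link] at hG
    have := hdim.2 _ hG.2
    rw [Finset.card_insert_of_notMem hG.1] at this
    lia

theorem facesOfDim_cone_deletion {p : ℕ} (hS : IsComplex S) (hdim : HasDim S d) :
    facesOfDim (cone p (deletion p S)) (d + 1) = (facesAvoiding p S d).image (insert p) := by
  ext F
  rw [mem_facesOfDim_cone_iff (fun G hG => ((mem_deletion hS).1 hG).1), Finset.mem_image]
  · refine exists_congr fun G => ?_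
    rw [mem_deletion hS, mem_facesAvoiding]
    constructor
    · rintro ⟨⟨hp, hG⟩, hcard, rfl⟩
      exact ⟨⟨⟨hG, hcard⟩, hp⟩, rfl⟩
    · rintro ⟨hG, rfl⟩
      exact ⟨⟨hG.2, hG.1.1⟩, hG.1.2, rfl⟩
  · intro G hG
    exact hdim.2 _ ((mem_deletion hS).1 hG).2

theorem IsShiftedOn.facesAvoiding {p : ℕ} (hS : IsShiftedOn p n S) :
    IsShiftedOn (p + 1) n (facesAvoiding p S d) := by
  refine ⟨fun F hF => ?_, ?_⟩
  · rw [mem_facesAvoiding] at hF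
    exact Finset.mem_powerset.1
      (mem_powerset_Icc_succ (Finset.mem_powerset.2 (hS.1 F hF.1.1)) hF.2)
  · intro F hF i hi j hj hij hiF hjF
    rw [mem_facesAvoiding] at hF ⊢
    refine ⟨⟨hS.2 F hF.1.1 i (Finset.Icc_subset_Icc_left (Nat.le_succ p) hi) j
      (Finset.Icc_subset_Icc_left (Nat.le_succ p) hj) hij hiF hjF, ?_⟩, ?_⟩
    · rw [Finset.card_insert_of_notMem fun h => hiF (Finset.mem_of_mem_erase h),
        Finset.card_erase_add_one hjF, hF.1.2]
    · rw [Finset.mem_insert]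
      rintro (rfl | h)
      · have := (Finset.mem_Icc.1 hi).1
        lia
      · exact hF.2 (Finset.mem_of_mem_erase h)

theorem IsShiftedOn.image_insert {p : ℕ} {K : Finset (Finset ℕ)} (hpn : p ≤ n)
    (hK : IsShiftedOn (p + 1) n K) : IsShiftedOn p n (K.image (insert p)) := by
  refine ⟨fun F hF => ?_, ?_⟩
  · obtain ⟨G, hG, rfl⟩ := Finset.mem_image.1 hF
    exact Finset.mem_powerset.1
      (insert_mem_powerset_Icc hpn (Finset.mem_powerset.2 (hK.1 G hG)))
  · intro F hF i hi j hj hij hiF hjF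
    obtain ⟨G, hG, rfl⟩ := Finset.mem_image.1 hF
    rw [Finset.mem_insert, not_or] at hiF
    have hi1 := Finset.mem_Icc.1 hi
    have hj1 := Finset.mem_Icc.1 hj
    have hjG : j ∈ G := (Finset.mem_insert.1 hjF).resolve_left (by lia)
    refine Finset.mem_image.2 ⟨insert i (G.erase j), hK.2 G hG i
      (Finset.mem_Icc.2 ⟨by lia, hi1.2⟩) j (Finset.mem_Icc.2 ⟨by lia, hj1.2⟩) hij hiF.2 hjG, ?_⟩
    rw [Finset.erase_insert_of_ne (by lia), Finset.insert_comm]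

theorem familyDegree_image_insert {p v : ℕ} {K : Finset (Finset ℕ)} (hK : ∀ F ∈ K, p ∉ F)
    (hv : v ≠ p) : familyDegree (K.image (insert p)) v = familyDegree K v := by
  rw [familyDegree, Finset.filter_image, Finset.card_image_of_injOn]
  · rw [familyDegree]
    congr 1
    ext F
    simp [hv]
  · intro F hF G hG h
    have hF := (Finset.mem_filter.1 hF).1
    have hG := (Finset.mem_filter.1 hG).1
    rw [← Finset.erase_insert (hK F hF), h, Finset.erase_insert (hK G hG)]

end ShiftedComplex

section WeightedDeterminant

variable {R : Type*}

theorem intCast_weightedIncidence [CommRing R] (G F : Finset ℕ) :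
    ((weightedIncidence (1 : ℕ → ℤ) G F : ℤ) : R) = weightedIncidence (1 : ℕ → R) G F := by
  simp [weightedIncidence, apply_ite]

theorem weightedIncidence_one_mul_prod [CommRing R] (x : ℕ → R) (G F : Finset ℕ) :
    weightedIncidence (1 : ℕ → R) G F * ∏ v ∈ F, x v =
      (∏ v ∈ G, x v) * weightedIncidence x G F := by
  rw [weightedIncidence, weightedIncidence, Finset.sum_mul, Finset.mul_sum]
  refine Finset.sum_congr rfl fun v hv => ?_
  by_cases h : F.erase v = G
  · rw [if_pos h, if_pos h, ← h, ← Finset.mul_prod_erase F x hv, Pi.one_apply]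
    ring
  · simp [h]

variable {n : ℕ} {d : ℤ} {S : Finset (Finset ℕ)}

/-- The reduced weighted Laplacian of a complex in which every `(d-1)`-face avoiding `p` lies in a
`d`-face containing `p`. -/
theorem det_reducedLaplacian [Field R] (x : ℕ → R) {p : ℕ} (hp0 : x p ≠ 0) (hS : IsComplex S)
    (hp : ∀ F ∈ S, F ⊆ Finset.Icc p n)
    (hins : ∀ G ∈ facesAvoiding p S (d - 1), insert p G ∈ S) :
    (Matrix.of fun G G' : {G // G ∈ facesAvoiding p S (d - 1)} => ∑ F ∈ facesOfDim S d,
      weightedIncidence (1 : ℕ → R) G.1 F *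
        ((∏ v ∈ F, x v) ^ 2 * weightedIncidence (1 : ℕ → R) G'.1 F)).det =
      (∏ F ∈ (facesAvoiding p S (d - 1)).image (insert p), ∏ v ∈ F, x v ^ 2) *
        gramDet x (p + 1) n (x p ^ 2) (facesAvoiding p S d) := by
  have hp1 : ∀ F ∈ S, ∀ v ∈ F, p ≤ v := fun F hF v hv => (Finset.mem_Icc.1 (hp F hF hv)).1
  have hpN : ∀ G ∈ facesAvoiding p S (d - 1), p ∉ G := fun G hG => (mem_facesAvoiding.1 hG).2
  have hinj : Set.InjOn (insert p) (facesAvoiding p S (d - 1) : Set (Finset ℕ)) := by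
    intro F hF G hG h
    rw [← Finset.erase_insert (hpN F hF), h, Finset.erase_insert (hpN G hG)]
  have hsplit : facesOfDim S d =
      (facesAvoiding p S (d - 1)).image (insert p) ∪ facesAvoiding p S d := by
    ext F
    rw [Finset.mem_union, Finset.mem_image]
    constructor
    · intro hF
      by_cases hpF : p ∈ F
      · refine Or.inl ⟨F.erase p, ?_, Finset.insert_erase hpF⟩
        exact Finset.mem_filter.2 ⟨erase_mem_facesOfDim hS (by ring) hF hpF,
          Finset.notMem_erase p F⟩
      · exact Or.inr (Finset.mem_filter.2 ⟨hF, hpF⟩)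
    · rintro (⟨G, hG, rfl⟩ | hF)
      · refine mem_facesOfDim.2 ⟨hins G hG, ?_⟩
        rw [Finset.card_insert_of_notMem (hpN G hG)]
        have := (mem_facesAvoiding.1 hG).1.2
        push_cast
        lia
      · exact (Finset.mem_filter.1 hF).1
  have hdisj : Disjoint ((facesAvoiding p S (d - 1)).image (insert p)) (facesAvoiding p S d) := by
    rw [Finset.disjoint_left]
    intro F hF hF'
    obtain ⟨G, _, rfl⟩ := Finset.mem_image.1 hF
    exact (mem_facesAvoiding.1 hF').2 (Finset.mem_insert_self p G)
  have hmat : (Matrix.of fun G G' : {G // G ∈ facesAvoiding p S (d - 1)} =>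
      ∑ F ∈ facesOfDim S d, weightedIncidence (1 : ℕ → R) G.1 F *
        ((∏ v ∈ F, x v) ^ 2 * weightedIncidence (1 : ℕ → R) G'.1 F)) =
      Matrix.of fun G G' : {G // G ∈ facesAvoiding p S (d - 1)} => (∏ v ∈ G.1, x v) *
        (Matrix.of fun G G' : {G // G ∈ facesAvoiding p S (d - 1)} => (∏ v ∈ G'.1, x v) *
          (x p ^ 2 • (1 + (x p ^ 2)⁻¹ •
            Matrix.of fun G G' : {G // G ∈ facesAvoiding p S (d - 1)} =>
              ∑ F ∈ facesAvoiding p S d,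
                weightedIncidence x G.1 F * weightedIncidence x G'.1 F)) G G') G G' := by
    ext G G'
    have hterm : ∀ F, weightedIncidence (1 : ℕ → R) G.1 F *
        ((∏ v ∈ F, x v) ^ 2 * weightedIncidence (1 : ℕ → R) G'.1 F) = (∏ v ∈ G.1, x v) *
          ((∏ v ∈ G'.1, x v) * (weightedIncidence x G.1 F * weightedIncidence x G'.1 F)) := by
      intro F
      linear_combination (weightedIncidence (1 : ℕ → R) G'.1 F * ∏ v ∈ F, x v) *
        weightedIncidence_one_mul_prod x G.1 F +
        (∏ v ∈ G.1, x v) * weightedIncidence x G.1 F * weightedIncidence_one_mul_prod x G'.1 F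
    have hdiag : ∑ F ∈ (facesAvoiding p S (d - 1)).image (insert p),
        weightedIncidence x G.1 F * weightedIncidence x G'.1 F =
          x p ^ 2 * (1 : Matrix _ _ R) G G' := by
      rw [Finset.sum_image hinj]
      have hval : ∀ H ∈ facesAvoiding p S (d - 1),
          weightedIncidence x G.1 (insert p H) * weightedIncidence x G'.1 (insert p H) =
            if G.1 = H then x p * (if G'.1 = H then x p else 0) else 0 := by
        intro H hH
        rw [weightedIncidence_insert_right x (fun v hv => lt_of_mem_facesAvoiding hp1 hH hv)
          (hpN _ G.2), weightedIncidence_insert_right x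
          (fun v hv => lt_of_mem_facesAvoiding hp1 hH hv) (hpN _ G'.2)]
        split_ifs <;> simp
      rw [Finset.sum_congr rfl hval, Finset.sum_ite_eq, if_pos G.2, Matrix.one_apply]
      by_cases h : G = G'
      · simp [h, pow_two]
      · rw [if_neg fun h' => h (Subtype.ext h'.symm), if_neg h, mul_zero, mul_zero]
    simp only [Matrix.of_apply, Matrix.smul_apply, Matrix.add_apply, smul_eq_mul, hterm]
    rw [← Finset.mul_sum, ← Finset.mul_sum, hsplit, Finset.sum_union hdisj, hdiag,
      mul_add (x p ^ 2), mul_inv_cancel_left₀ (pow_ne_zero 2 hp0)]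
  rw [hmat, Matrix.det_mul_column, Matrix.det_mul_row, Matrix.det_smul,
    ← gramDet_eq_det x (x p ^ 2), ← mul_assoc, ← mul_assoc]
  · congr 1
    rw [Finset.prod_image hinj, Fintype.card_coe, ← Finset.prod_const,
      Finset.prod_coe_sort (facesAvoiding p S (d - 1)) fun G => ∏ v ∈ G, x v,
      ← Finset.prod_mul_distrib, ← Finset.prod_mul_distrib]
    refine Finset.prod_congr rfl fun G hG => ?_
    rw [Finset.prod_insert (hpN G hG), Finset.prod_pow]
    ring
  · intro F hF
    rw [mem_facesAvoiding] at hF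
    exact mem_powerset_Icc_succ (Finset.mem_powerset.2 (hp F hF.1.1)) hF.2
  · intro F hF v hv
    obtain ⟨hF, hpF⟩ := Finset.mem_filter.1 hF
    exact Finset.mem_filter.2 ⟨erase_mem_facesOfDim hS (by ring) hF hv,
      fun h => hpF (Finset.mem_of_mem_erase h)⟩

end WeightedDeterminant

section SpanningTrees

theorem det_submatrix_equiv_ne_zero_iff {m n : Type*} [Fintype m] [DecidableEq m] [Fintype n]
    (M : Matrix m n ℤ) (e : m ≃ n) :
    (M.submatrix id e).det ≠ 0 ↔ ∀ c, M.mulVec c = 0 → c = 0 := by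
  constructor
  · intro h c hc
    by_contra hne
    refine h (Matrix.exists_mulVec_eq_zero_iff.1 ⟨c ∘ e, fun h0 => hne ?_, ?_⟩)
    · ext i
      simpa using congrFun h0 (e.symm i)
    · have := Matrix.submatrix_mulVec_equiv M (c ∘ e) id e
      simpa [Function.comp_assoc, hc] using this
  · intro h hdet
    obtain ⟨c, hne, hc⟩ := Matrix.exists_mulVec_eq_zero_iff.2 hdet
    refine hne ?_
    have h1 := Matrix.submatrix_mulVec_equiv M c id e
    have h2 := h (c ∘ e.symm) (by simpa [hc] using h1.symm)
    ext i
    simpa using congrFun h2 (e i)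

variable {p : ℕ} {d : ℤ} {S J : Finset (Finset ℕ)}

theorem mem_skeleton {i : ℤ} {F : Finset ℕ} : F ∈ skeleton S i ↔ F ∈ S ∧ (F.card : ℤ) ≤ i + 1 :=
  Finset.mem_filter

theorem isComplex_skeleton_union (hS : IsComplex S) (hd : 0 ≤ d) (hJ : J ⊆ facesOfDim S d) :
    IsComplex (skeleton S (d - 1) ∪ J) := by
  refine ⟨Finset.mem_union_left _ (mem_skeleton.2 ⟨hS.1, by simp [hd]⟩), ?_⟩
  intro F hF G hGF
  rcases eq_or_ne G F with rfl | hne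
  · exact hF
  have hlt := Finset.card_lt_card (hGF.ssubset_of_ne hne)
  refine Finset.mem_union_left _ (mem_skeleton.2 ?_)
  rcases Finset.mem_union.1 hF with hF | hF
  · rw [mem_skeleton] at hF
    exact ⟨hS.2 F hF.1 G hGF, by lia⟩
  · have := mem_facesOfDim.1 (hJ hF)
    exact ⟨hS.2 F this.1 G hGF, by lia⟩

theorem skeleton_union_subset (hJ : J ⊆ facesOfDim S d) : skeleton S (d - 1) ∪ J ⊆ S :=
  Finset.union_subset (Finset.filter_subset _ _) (hJ.trans (Finset.filter_subset _ _))

theorem facesOfDim_skeleton_union (hJ : J ⊆ facesOfDim S d) :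
    facesOfDim (skeleton S (d - 1) ∪ J) d = J := by
  ext F
  rw [mem_facesOfDim, Finset.mem_union, mem_skeleton]
  constructor
  · rintro ⟨⟨-, hF⟩ | hF, hF'⟩
    · lia
    · exact hF
  · intro hF
    exact ⟨Or.inr hF, (mem_facesOfDim.1 (hJ hF)).2⟩

theorem skeleton_skeleton_union (hJ : J ⊆ facesOfDim S d) :
    skeleton (skeleton S (d - 1) ∪ J) (d - 1) = skeleton S (d - 1) := by
  ext F
  rw [mem_skeleton, Finset.mem_union, mem_skeleton]
  constructor
  · rintro ⟨h | hF, hF'⟩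
    · exact h
    · have := (mem_facesOfDim.1 (hJ hF)).2
      lia
  · intro hF
    exact ⟨Or.inl hF, hF.2⟩

theorem facesAvoiding_skeleton_union (hJ : J ⊆ facesOfDim S d) :
    facesAvoiding p (skeleton S (d - 1) ∪ J) (d - 1) = facesAvoiding p S (d - 1) := by
  ext F
  rw [mem_facesAvoiding, mem_facesAvoiding, Finset.mem_union, mem_skeleton]
  constructor
  · rintro ⟨⟨h | hF, hF'⟩, hp⟩
    · exact ⟨⟨h.1, hF'⟩, hp⟩
    · have := (mem_facesOfDim.1 (hJ hF)).2
      lia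
  · rintro ⟨hF, hp⟩
    exact ⟨⟨Or.inl ⟨hF.1, hF.2.le⟩, hF.2⟩, hp⟩

theorem facesOfDim_succ_skeleton_union (hJ : J ⊆ facesOfDim S d) :
    facesOfDim (skeleton S (d - 1) ∪ J) (d + 1) = ∅ := by
  refine Finset.eq_empty_of_forall_notMem fun F hF => ?_
  rw [mem_facesOfDim, Finset.mem_union, mem_skeleton] at hF
  obtain ⟨⟨-, h⟩ | h, hF'⟩ := hF
  · lia
  · have := (mem_facesOfDim.1 (hJ h)).2
    lia

/-- A subcomplex with full `(d-1)`-skeleton is the skeleton together with its `d`-faces. -/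
theorem skeleton_union_facesOfDim {T : Finset (Finset ℕ)} (hdim : HasDim T d)
    (hskel : skeleton T (d - 1) = skeleton S (d - 1)) :
    skeleton S (d - 1) ∪ facesOfDim T d = T := by
  rw [← hskel]
  ext F
  rw [Finset.mem_union, mem_skeleton, mem_facesOfDim, ← and_or_left, and_iff_left_iff_imp]
  intro hF
  have := hdim.2 F hF
  lia

/-- The square submatrix of the boundary matrix with rows the `(d-1)`-faces avoiding `p` and columns
given by an enumeration `e`. -/
def reducedMinor (p : ℕ) (S : Finset (Finset ℕ)) (d : ℤ) {J : Finset (Finset ℕ)}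
    (e : {G // G ∈ facesAvoiding p S (d - 1)} ≃ J) :
    Matrix {G // G ∈ facesAvoiding p S (d - 1)} {G // G ∈ facesAvoiding p S (d - 1)} ℤ :=
  Matrix.of fun G G' => weightedIncidence (1 : ℕ → ℤ) G.1 (e G').1

theorem exists_equiv_reducedBoundary {T : Finset (Finset ℕ)} {i : ℤ}
    (e : {G // G ∈ facesAvoiding p S (d - 1)} ≃ J)
    (hN : facesAvoiding p T (d - 1) = facesAvoiding p S (d - 1)) (hJ : facesOfDim T i = J) :
    ∃ e' : {G // G ∈ facesAvoiding p T (d - 1)} ≃ {F // F ∈ facesOfDim T i},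
      ((reducedBoundary p T i (d - 1)).submatrix id e').det = (reducedMinor p S d e).det := by
  subst hJ
  let a : {G // G ∈ facesAvoiding p T (d - 1)} ≃ {G // G ∈ facesAvoiding p S (d - 1)} :=
    Equiv.subtypeEquivRight fun G => by rw [hN]
  refine ⟨a.trans e, ?_⟩
  rw [← Matrix.det_submatrix_equiv_self a (reducedMinor p S d e)]
  rfl

theorem det_reducedMinor_ne_zero_iff (hS : IsComplex S) (hd : 0 ≤ d)
    (hp : ∀ F ∈ S, ∀ v ∈ F, p ≤ v) (hJ : J ⊆ facesOfDim S d)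
    (e : {G // G ∈ facesAvoiding p S (d - 1)} ≃ J) :
    (reducedMinor p S d e).det ≠ 0 ↔ Subsingleton (RedHomology (skeleton S (d - 1) ∪ J) d) := by
  obtain ⟨e', he'⟩ := exists_equiv_reducedBoundary e (facesAvoiding_skeleton_union hJ)
    (facesOfDim_skeleton_union hJ)
  rw [← he', det_submatrix_equiv_ne_zero_iff, subsingleton_redHomology_iff
    (isComplex_skeleton_union hS hd hJ) (fun F hF => hp F (skeleton_union_subset hJ hF))
    (facesOfDim_succ_skeleton_union hJ)]

theorem natCard_redHomology_eq (hS : IsComplex S) (hd : 0 ≤ d) (hp : ∀ F ∈ S, ∀ v ∈ F, p ≤ v)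
    (hcone : ∀ G ∈ facesAvoiding p S (d - 1), ∀ v ∈ G, insert p (G.erase v) ∈ S)
    (hJ : J ⊆ facesOfDim S d) (e : {G // G ∈ facesAvoiding p S (d - 1)} ≃ J)
    (h : (reducedMinor p S d e).det ≠ 0) :
    Nat.card (RedHomology (skeleton S (d - 1) ∪ J) (d - 1)) =
      (reducedMinor p S d e).det.natAbs := by
  obtain ⟨e', he'⟩ := exists_equiv_reducedBoundary (i := d - 1 + 1) e
    (facesAvoiding_skeleton_union hJ) (by rw [sub_add_cancel, facesOfDim_skeleton_union hJ])
  rw [← he'] at h ⊢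
  refine natCard_homology (isComplex_skeleton_union hS hd hJ)
    (fun F hF => hp F (skeleton_union_subset hJ hF)) rfl (by ring) ?_ e' h
  rw [facesAvoiding_skeleton_union hJ]
  intro G hG v hv
  refine Finset.mem_union_left _ (mem_skeleton.2 ⟨hcone G hG v hv, ?_⟩)
  have := (mem_facesAvoiding.1 hG).1.2
  have h1 := Finset.card_insert_le p (G.erase v)
  have h2 := Finset.card_erase_add_one hv
  lia

end SpanningTrees

section MatrixTree

variable {p : ℕ} {d : ℤ} {S J : Finset (Finset ℕ)}

theorem isSpanningTree_skeleton_union_iff (hS : IsComplex S) (hd : 0 ≤ d)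
    (hp : ∀ F ∈ S, ∀ v ∈ F, p ≤ v)
    (hcone : ∀ G ∈ facesAvoiding p S (d - 1), ∀ v ∈ G, insert p (G.erase v) ∈ S)
    (hne : (facesAvoiding p S (d - 1)).Nonempty) (hlow : redBetti S (d - 1) = 0)
    (htop : redBetti S d + (facesAvoiding p S (d - 1)).card = (facesOfDim S d).card)
    (hJ : J ⊆ facesOfDim S d) (e : {G // G ∈ facesAvoiding p S (d - 1)} ≃ J) :
    IsSpanningTree S d (skeleton S (d - 1) ∪ J) ↔ (reducedMinor p S d e).det ≠ 0 := by
  refine ⟨fun h => (det_reducedMinor_ne_zero_iff hS hd hp hJ e).2 h.acyclic, fun h => ?_⟩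
  have hcard : J.card = (facesAvoiding p S (d - 1)).card := by
    simpa using (Fintype.card_congr e).symm
  refine ⟨isComplex_skeleton_union hS hd hJ, skeleton_union_subset hJ, ⟨?_, ?_⟩,
    skeleton_skeleton_union hJ, (det_reducedMinor_ne_zero_iff hS hd hp hJ e).1 h, ?_, ?_⟩
  · obtain ⟨F, hF⟩ : J.Nonempty := by rwa [← Finset.card_pos, hcard, Finset.card_pos]
    exact ⟨F, Finset.mem_union_right _ hF, (mem_facesOfDim.1 (hJ hF)).2⟩
  · intro F hF
    rcases Finset.mem_union.1 hF with hF | hF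
    · have := (mem_skeleton.1 hF).2
      lia
    · exact (mem_facesOfDim.1 (hJ hF)).2.le
  · apply Nat.finite_of_card_ne_zero
    rw [natCard_redHomology_eq hS hd hp hcone hJ e h]
    exact Int.natAbs_ne_zero.2 h
  · rw [facesOfDim_skeleton_union hJ, hlow, hcard]
    lia

open Classical in
/-- The weighted simplicial matrix–tree theorem, with the reduced Laplacian obtained by deleting the
`(d-1)`-faces that contain `p`. -/
theorem treeEnumerator_eq_det {R : Type*} [CommRing R] (x : Finset ℕ → R) (hS : IsComplex S)
    (hd : 0 ≤ d) (hp : ∀ F ∈ S, ∀ v ∈ F, p ≤ v)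
    (hcone : ∀ G ∈ facesAvoiding p S (d - 1), ∀ v ∈ G, insert p (G.erase v) ∈ S)
    (hne : (facesAvoiding p S (d - 1)).Nonempty) (hlow : redBetti S (d - 1) = 0)
    (htop : redBetti S d + (facesAvoiding p S (d - 1)).card = (facesOfDim S d).card) :
    treeEnumerator S d x =
      (Matrix.of fun G G' : {G // G ∈ facesAvoiding p S (d - 1)} => ∑ F ∈ facesOfDim S d,
        weightedIncidence (1 : ℕ → R) G.1 F *
          (x F ^ 2 * weightedIncidence (1 : ℕ → R) G'.1 F)).det := by
  let c : Finset (Finset ℕ) → R := fun J =>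
    if IsSpanningTree S d (skeleton S (d - 1) ∪ J) then
      (Nat.card (RedHomology (skeleton S (d - 1) ∪ J) (d - 1)) : R) ^ 2 * ∏ F ∈ J, x F ^ 2
    else 0
  have hCB := det_sum_mul_eq_sum_powersetCard (facesOfDim S d)
    (Matrix.of fun (G : {G // G ∈ facesAvoiding p S (d - 1)}) F =>
      weightedIncidence (1 : ℕ → R) G.1 F)
    (Matrix.of fun F (G : {G // G ∈ facesAvoiding p S (d - 1)}) =>
      x F ^ 2 * weightedIncidence (1 : ℕ → R) G.1 F) c ?_
  · refine Eq.trans ?_ hCB.symm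
    simp only [c]
    rw [← Finset.sum_filter, treeEnumerator]
    refine Finset.sum_bij' (fun T _ => facesOfDim T d) (fun J _ => skeleton S (d - 1) ∪ J)
      ?_ ?_ ?_ ?_ ?_
    · intro T hT
      have hT := (Finset.mem_filter.1 hT).2
      refine Finset.mem_filter.2 ⟨Finset.mem_powersetCard.2
        ⟨Finset.filter_subset_filter _ hT.subset, ?_⟩, ?_⟩
      · have := hT.count
        rw [Fintype.card_coe]
        lia
      · rwa [skeleton_union_facesOfDim hT.hasDim hT.skeleton_eq]
    · intro J hJ
      obtain ⟨hJ, hT⟩ := Finset.mem_filter.1 hJ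
      exact Finset.mem_filter.2 ⟨Finset.mem_powerset.2 hT.subset, hT⟩
    · intro T hT
      have hT := (Finset.mem_filter.1 hT).2
      exact skeleton_union_facesOfDim hT.hasDim hT.skeleton_eq
    · intro J hJ
      exact facesOfDim_skeleton_union (Finset.mem_powersetCard.1 (Finset.mem_filter.1 hJ).1).1
    · intro T hT
      have hT := (Finset.mem_filter.1 hT).2
      rw [skeleton_union_facesOfDim hT.hasDim hT.skeleton_eq]
  · intro J hJ e
    have hA : ((Matrix.of fun (G : {G // G ∈ facesAvoiding p S (d - 1)}) F =>
        weightedIncidence (1 : ℕ → R) G.1 F).submatrix id fun i => (e i : Finset ℕ)).det =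
        ((reducedMinor p S d e).det : R) := by
      rw [Int.cast_det]
      congr 1
      ext G G'
      exact (intCast_weightedIncidence G.1 (e G').1).symm
    have hB : ((Matrix.of fun F (G : {G // G ∈ facesAvoiding p S (d - 1)}) =>
        x F ^ 2 * weightedIncidence (1 : ℕ → R) G.1 F).submatrix
          (fun i => (e i : Finset ℕ)) id).det =
        (∏ F ∈ J, x F ^ 2) * ((reducedMinor p S d e).det : R) := by
      rw [← hA, ← Finset.prod_coe_sort J, ← e.prod_comp,
        ← Matrix.det_transpose (Matrix.submatrix _ _ _),
        ← Matrix.det_transpose (Matrix.submatrix _ id _), ← Matrix.det_mul_column]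
      rw [Matrix.det_transpose]
      rfl
    rw [hA, hB]
    by_cases h : (reducedMinor p S d e).det = 0
    · have hT := mt (isSpanningTree_skeleton_union_iff hS hd hp hcone hne hlow htop hJ e).1
        (not_not.2 h)
      simp only [c, if_neg hT, h, Int.cast_zero, zero_mul]
    · have hT := (isSpanningTree_skeleton_union_iff hS hd hp hcone hne hlow htop hJ e).2 h
      simp only [c, if_pos hT]
      rw [natCard_redHomology_eq hS hd hp hcone hJ e h]
      have hsq : ((((reducedMinor p S d e).det.natAbs : ℕ) : R)) ^ 2 =
          ((reducedMinor p S d e).det : R) ^ 2 := by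
        rw [← Int.cast_natCast, ← Int.cast_pow, Int.natAbs_sq, Int.cast_pow]
      rw [hsq]
      ring

end MatrixTree

/-- The product formula for the tree enumerator of a shifted complex, for vertex weights in a field
whose partial sums of squares do not vanish. -/
theorem treeEnumerator_shifted {R : Type*} [Field R] (x : ℕ → R) (n d : ℕ)
    (S : Finset (Finset ℕ)) (hS : IsComplex S) (hdim : HasDim S d) (hshift : IsShiftedOn 1 n S)
    (hAPC : IsAPC S d) (hx : ∀ v, 2 ≤ v → ∑ i ∈ Finset.Ico 1 v, x i ^ 2 ≠ 0) :
    treeEnumerator S d (fun F => ∏ v ∈ F, x v) =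
      (∏ v ∈ Finset.Icc 1 n,
        (x v ^ 2) ^ familyDegree (facesOfDim (cone 1 (link 1 S)) d) v) *
      ∏ i ∈ Finset.Icc 1
          (conjLength n (familyDegree (facesOfDim (cone 1 (deletion 1 S)) (d + 1)))),
        ((∑ j ∈ Finset.Icc 1
            (conjPart n (familyDegree (facesOfDim (cone 1 (deletion 1 S)) (d + 1))) i), x j ^ 2) /
          x 1 ^ 2) := by
  have hp : ∀ F ∈ S, ∀ v ∈ F, 1 ≤ v := fun F hF v hv => (Finset.mem_Icc.1 (hshift.1 F hF hv)).1
  obtain ⟨F₀, hF₀, hF₀card⟩ := hdim.1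
  obtain ⟨v₀, hv₀⟩ : F₀.Nonempty := by
    rw [← Finset.card_pos]
    lia
  have hn : 1 ≤ n := by
    have := Finset.mem_Icc.1 (hshift.1 F₀ hF₀ hv₀)
    lia
  have hlow : redBetti S ((d : ℤ) - 1) = 0 := hAPC _ (by lia)
  have hcone : ∀ G ∈ facesAvoiding 1 S ((d : ℤ) - 1), ∀ v ∈ G, insert 1 (G.erase v) ∈ S := by
    intro G hG v hv
    have hG' := mem_facesAvoiding.1 hG
    exact hshift.2 G hG'.1.1 1 (Finset.left_mem_Icc.2 hn) v (hshift.1 G hG'.1.1 hv)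
      (lt_of_mem_facesAvoiding hp hG hv) hG'.2 hv
  have hins : ∀ G ∈ facesAvoiding 1 S ((d : ℤ) - 1), insert 1 G ∈ S := fun G hG =>
    insert_mem_of_redBetti_eq_zero hshift hn hlow hG
  have hins' : ∀ G ∈ facesAvoiding 1 S ((d : ℤ) - 1), insert 1 G ∈ facesOfDim S (d : ℤ) := by
    intro G hG
    have hG' := mem_facesAvoiding.1 hG
    refine mem_facesOfDim.2 ⟨hins G hG, ?_⟩
    rw [Finset.card_insert_of_notMem hG'.2]
    push_cast
    lia
  have hne : (facesAvoiding 1 S ((d : ℤ) - 1)).Nonempty := by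
    have key : ∀ v ∈ F₀, 1 ∉ F₀.erase v → (facesAvoiding 1 S ((d : ℤ) - 1)).Nonempty :=
      fun v hv h => ⟨F₀.erase v, Finset.mem_filter.2 ⟨erase_mem_facesOfDim hS (by ring)
        (mem_facesOfDim.2 ⟨hF₀, hF₀card⟩) hv, h⟩⟩
    by_cases h1 : 1 ∈ F₀
    · exact key 1 h1 (Finset.notMem_erase 1 F₀)
    · exact key v₀ hv₀ fun h => h1 (Finset.mem_of_mem_erase h)
  have htop := redBetti_add_card hS hp (facesOfDim_succ_eq_empty hdim) hins'
  have hx1 : x 1 ≠ 0 := by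
    have := hx 2 le_rfl
    simpa using this
  rw [treeEnumerator_eq_det _ hS (Int.natCast_nonneg d) hp hcone hne hlow htop,
    det_reducedLaplacian x hx1 hS hshift.1 hins, facesOfDim_cone_link hS hdim hins,
    facesOfDim_cone_deletion hS hdim]
  congr 1
  · rw [prod_pow_familyDegree]
    intro F hF
    obtain ⟨G, hG, rfl⟩ := Finset.mem_image.1 hF
    exact hshift.1 _ (hins G hG)
  · have hK : IsShiftedOn 2 n (facesAvoiding 1 S (d : ℤ)) := hshift.facesAvoiding
    have hg2 : ∑ i ∈ Finset.Ico 1 2, x i ^ 2 = x 1 ^ 2 := by simp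
    have hgram := gramDet_eq_prod x (g := fun v => ∑ i ∈ Finset.Ico 1 v, x i ^ 2) hx
      (fun v hv => Finset.sum_Ico_succ_top (by lia) _) hK
    have hconj := prod_conjPart (g := fun v => ∑ i ∈ Finset.Ico 1 v, x i ^ 2) hx (n := n)
      (l := familyDegree ((facesAvoiding 1 S (d : ℤ)).image (insert 1)))
      (fun v hv w hw hvw => (hK.image_insert hn).familyDegree_le hv hw hvw)
    simp only [hg2] at hgram hconj
    rw [hgram]
    refine Eq.trans (Finset.prod_congr rfl fun v hv => ?_) (hconj.symm.trans ?_)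
    · rw [familyDegree_image_insert (fun F hF => (mem_facesAvoiding.1 hF).2)]
      have := (Finset.mem_Icc.1 hv).1
      lia
    · rfl

theorem sum_XVar_ne_zero (𝕜 : Type*) [Field 𝕜] [CharZero 𝕜] {v : ℕ} (hv : 2 ≤ v) :
    ∑ i ∈ Finset.Ico 1 v, xVar 𝕜 i ^ 2 ≠ 0 := by
  have h : ∑ i ∈ Finset.Ico 1 v, xVar 𝕜 i ^ 2 =
      algebraMap (MvPolynomial ℕ 𝕜) (FractionRing (MvPolynomial ℕ 𝕜))
        (∑ i ∈ Finset.Ico 1 v, MvPolynomial.X i ^ 2) := by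
    simp [xVar]
  rw [h, Ne, FaithfulSMul.algebraMap_eq_zero_iff]
  intro h0
  have h1 := congrArg (MvPolynomial.eval fun _ => (1 : 𝕜)) h0
  simp only [map_sum, map_pow, MvPolynomial.eval_X, one_pow, Finset.sum_const, Nat.card_Ico,
    nsmul_eq_mul, mul_one, map_zero, Nat.cast_eq_zero] at h1
  lia

theorem corollary8p2 (𝕜 : Type*) [Field 𝕜] [CharZero 𝕜] (n d : ℕ) (S : Finset (Finset ℕ))
    (hcomplex : IsComplex S) (hdim : HasDim S d) (hshifted : IsShiftedOn 1 n S)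
    (hAPC : IsAPC S d) :
    treeEnumerator S d (coarseWeight 𝕜) =
      (∏ v ∈ Finset.Icc 1 n,
        XVar 𝕜 v ^ familyDegree (facesOfDim (cone 1 (link 1 S)) d) v) *
      ∏ i ∈ Finset.Icc 1
          (conjLength n (familyDegree (facesOfDim (cone 1 (deletion 1 S)) (d + 1)))),
        (EForm 𝕜 (conjPart n (familyDegree (facesOfDim (cone 1 (deletion 1 S)) (d + 1))) i) /
          XVar 𝕜 1) :=
  treeEnumerator_shifted (xVar 𝕜) n d S hcomplex hdim hshifted hAPC
    fun _ hv => sum_XVar_ne_zero 𝕜 hv
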